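/- Let $\mathbb K=\mathbb R$ or $\mathbb C$, let $P_n$ be the Legendre polynomials and $U_n$ the Chebyshev polynomials of the second kind, and let $$\mathcal Q^{1/2}u(x)=\frac1{\sqrt\pi}\int_{-1}^x\frac{u(t)}{\sqrt{x-t}}\,dt$$ be the left-sided half-integral, a bounded operator on $L^2[-1,1]$ ($\mathbb K$-valued functions). In coefficients it is given, from the basis $(P_n)$ to the basis $(\sqrt{1+x}\,U_n)$, by the upper bidiagonal matrix $Q_{\mathbf P}$ with $$(Q_{\mathbf P})_{n,n}=\frac{2}{\sqrt\pi\,(2n+1)},\qquad (Q_{\mathbf P})_{n-1,n}=-\frac{2}{\sqrt\pi\,(2n+1)},$$ and from $(\sqrt{1+x}\,U_n)$ to $(P_n)$ by the lower bidiagonal matrix $Q_{\mathbf U}$ with $(Q_{\mathbf U})_{n,n}=(Q_{\mathbf U})_{n+1,n}=\frac{\sqrt\pi}{2}$ (indices start at $0$, all other entries vanish). Let $\sigma\in\mathbb K$ be such that $\sigma I+\mathcal Q^{1/2}$ is invertible on $L^2[-1,1]$. Let $\underline e=(e_n)_{n\ge0}$ and $\underline f=(f_n)_{n\ge0}$ be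 sequences in $\ell^1$, let $e(x)=\sum_{n\ge0}e_nP_n(x)$ and $f(x)=\sum_{n\ge0}f_nU_n(x)$ for almost every $x\in[-1,1]$, and suppose that the expansion of the weighted part of the right-hand side converges in $L^2[-1,1]$, that is, $$\sqrt{1+x}\,\sum_{n<N}f_nU_n(x)\longrightarrow\sqrt{1+x}\,f(x)\quad\text{in }L^2[-1,1]\text{ as }N\to\infty .$$ (This holds, for example, if $\sum_n (n+1)|f_n|<\infty$, in particular if $f$ is smooth on $[-1,1]$.) Then the equation $$\sigma u(x)+\mathcal Q^{1/2}u(x)=e(x)+\sqrt{1+x}\,f(x)\qquad\text{for a.e. }x\in[-1,1]$$ has exactly one solution $u\in L^2[-1,1]$; for all sufficiently large $N$ the $2N\times2N$ finite section $$\begin{pmatrix}\sigma I_N & (Q_{\mathbf U})_N\\ (Q_{\mathbf P})_N&\sigma I_N\end{pmatrix}\begin{pmatrix}\underline a_N\\ \underline b_N\end{pmatrix}=\begin{pmatrix}(e_0,\dots,e_{N-1})^\top\\ (f_0,\dots,f_{N-1})^\top\end{pmatrix},$$ where $(\cdot)_N$ is the leading $N\times N$ block, is invertible; and the functions $$u_N(x)=\sum_{n<N}a_{N,n}P_n(x)+\sqrt{1+x}\sum_{n<N}b_{N,n}U_n(x)$$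 converge to $u$ in $L^2[-1,1]$ as $N\to\infty$. -/

import Mathlib

open MeasureTheory Filter Topology

namespace HalfOrder

/-! ### The space `L²[-1,1]` -/

/-- Lebesgue measure on `[-1,1]`. -/
noncomputable abbrev vol : Measure ℝ := volume.restrict (Set.Icc (-1 : ℝ) 1)

/-- The Hilbert space `L²[-1,1]` of `𝕜`-valued functions. -/
abbrev L2 (𝕜 : Type*) [RCLike 𝕜] : Type _ := Lp 𝕜 2 vol

/-! ### The half-integral -/

/-- The left-sided half-integral
`(Q^{1/2} u)(x) = (1/√π) ∫_{-1}^x u(t) / (x-t)^{1/2} dt`. -/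
noncomputable def halfIntegral {𝕜 : Type*} [RCLike 𝕜] (u : ℝ → 𝕜) (x : ℝ) : 𝕜 :=
  ((1 / √Real.pi : ℝ) : 𝕜) * ∫ t in (-1 : ℝ)..x, u t / ((√(x - t) : ℝ) : 𝕜)

/-- The kernel `s ↦ s^{-1/2}` for `s > 0`, and `0` for `s ≤ 0`. -/
noncomputable def ker (s : ℝ) : ℝ := (√s)⁻¹

theorem measurable_ker : Measurable ker :=
  (Real.continuous_sqrt.measurable).inv

theorem ker_nonneg (s : ℝ) : 0 ≤ ker s := inv_nonneg.2 (Real.sqrt_nonneg s)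

theorem ker_of_nonpos {s : ℝ} (hs : s ≤ 0) : ker s = 0 := by
  simp [ker, Real.sqrt_eq_zero_of_nonpos hs]

/-- The total mass of the kernel on `[-2,2]`. -/
noncomputable def kerMass : ENNReal :=
  ∫⁻ s, (Set.Icc (-2 : ℝ) 2).indicator (fun s => ENNReal.ofReal (ker s)) s

theorem kerMass_lt_top : kerMass < ⊤ := by
  have h1 : IntegrableOn ker (Set.Ioc 0 2) := by
    have h := (intervalIntegral.intervalIntegrable_rpow' (a := 0) (b := 2)
      (r := -(1/2 : ℝ)) (by norm_num)).1
    refine h.congr_fun (fun s hs => ?_) measurableSet_Ioc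
    simp only [ker]
    rw [Real.sqrt_eq_rpow, Real.rpow_neg hs.1.le]
  have h2 : ∀ s, (Set.Icc (-2 : ℝ) 2).indicator (fun s => ENNReal.ofReal (ker s)) s
      = (Set.Ioc (0 : ℝ) 2).indicator (fun s => ENNReal.ofReal (ker s)) s := by
    intro s
    by_cases hs : s ≤ 0
    · have : s ∉ Set.Ioc (0 : ℝ) 2 := fun h => absurd h.1 (not_lt.2 hs)
      simp [Set.indicator, ker_of_nonpos hs]
    · have : s ∈ Set.Icc (-2 : ℝ) 2 ↔ s ∈ Set.Ioc (0 : ℝ) 2 :=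
        ⟨fun h => ⟨not_le.1 hs, h.2⟩, fun h => ⟨by linarith [h.1], h.2⟩⟩
      simp [Set.indicator, this]
  unfold kerMass
  simp_rw [h2]
  rw [lintegral_indicator measurableSet_Ioc]
  have h3 := h1.2
  rw [hasFiniteIntegral_iff_ofReal (Eventually.of_forall ker_nonneg)] at h3
  exact h3

theorem lintegral_ker_left {x : ℝ} (hx : x ∈ Set.Icc (-1 : ℝ) 1) :
    ∫⁻ t, ENNReal.ofReal (ker (x - t)) ∂vol ≤ kerMass := by
  rw [← lintegral_indicator measurableSet_Icc, kerMass,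
    ← lintegral_sub_left_eq_self
      (fun s => (Set.Icc (-2 : ℝ) 2).indicator (fun s => ENNReal.ofReal (ker s)) s) x]
  refine lintegral_mono fun t => ?_
  by_cases ht : t ∈ Set.Icc (-1 : ℝ) 1
  · have : x - t ∈ Set.Icc (-2 : ℝ) 2 :=
      ⟨by linarith [hx.1, ht.2], by linarith [hx.2, ht.1]⟩
    simp only [Set.indicator, ht, this, if_true, le_refl]
  · simp only [Set.indicator, ht, if_false, zero_le]

theorem lintegral_ker_right {t : ℝ} (ht : t ∈ Set.Icc (-1 : ℝ) 1) :
    ∫⁻ x, ENNReal.ofReal (ker (x - t)) ∂vol ≤ kerMass := by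
  rw [← lintegral_indicator measurableSet_Icc, kerMass,
    ← lintegral_sub_right_eq_self
      (fun s => (Set.Icc (-2 : ℝ) 2).indicator (fun s => ENNReal.ofReal (ker s)) s) t]
  refine lintegral_mono fun x => ?_
  by_cases hx : x ∈ Set.Icc (-1 : ℝ) 1
  · have : x - t ∈ Set.Icc (-2 : ℝ) 2 :=
      ⟨by linarith [hx.1, ht.2], by linarith [hx.2, ht.1]⟩
    simp only [Set.indicator, hx, this, if_true, le_refl]
  · simp only [Set.indicator, hx, if_false, zero_le]

theorem cauchy_schwarz_ker {k v : ℝ → ENNReal} {ν : Measure ℝ} (hk : AEMeasurable k ν)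
    (hv : AEMeasurable v ν) :
    (∫⁻ t, k t * v t ∂ν) ^ (2 : ℝ) ≤ (∫⁻ t, k t ∂ν) * ∫⁻ t, k t * v t ^ (2 : ℝ) ∂ν := by
  have hpq : (2 : ℝ).HolderConjugate 2 := Real.HolderConjugate.two_two
  have h := ENNReal.lintegral_mul_le_Lp_mul_Lq ν hpq
    (hk.pow_const (1 / 2 : ℝ)) ((hk.pow_const (1 / 2 : ℝ)).mul hv)
  have e1 : ∀ a : ENNReal, a ^ (1 / 2 : ℝ) * a ^ (1 / 2 : ℝ) = a := fun a => by
    rw [← ENNReal.rpow_add_of_nonneg _ _ (by norm_num) (by norm_num)]; norm_num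
  have e2 : ∀ a : ENNReal, (a ^ (1 / 2 : ℝ)) ^ (2 : ℝ) = a := fun a => by
    rw [← ENNReal.rpow_mul]; norm_num
  simp only [Pi.mul_apply, ← mul_assoc, e1, e2,
    ENNReal.mul_rpow_of_nonneg _ _ (show (0 : ℝ) ≤ 2 by norm_num)] at h
  have h' := ENNReal.rpow_le_rpow h (show (0 : ℝ) ≤ 2 by norm_num)
  rwa [ENNReal.mul_rpow_of_nonneg _ _ (show (0 : ℝ) ≤ 2 by norm_num), e2, e2] at h'

theorem aemeasurable_ker (x : ℝ) :
    AEMeasurable (fun t => ENNReal.ofReal (ker (x - t))) vol :=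
  (measurable_ker.comp (measurable_const.sub measurable_id)).ennreal_ofReal.aemeasurable

/-- The `L²` bound for the positive operator with kernel `(x-t)^{-1/2}`. -/
theorem lintegral_sq_le {v : ℝ → ENNReal} (hv : AEMeasurable v vol) :
    ∫⁻ x, (∫⁻ t, ENNReal.ofReal (ker (x - t)) * v t ∂vol) ^ (2 : ℝ) ∂vol
      ≤ kerMass * (kerMass * ∫⁻ t, v t ^ (2 : ℝ) ∂vol) := by
  have hmeas : AEMeasurable (Function.uncurry fun x t : ℝ =>
      ENNReal.ofReal (ker (x - t)) * v t ^ (2 : ℝ)) (vol.prod vol) := by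
    refine AEMeasurable.mul ?_ ?_
    · exact (measurable_ker.comp (measurable_fst.sub measurable_snd)).ennreal_ofReal.aemeasurable
    · exact (hv.pow_const 2).comp_quasiMeasurePreserving Measure.quasiMeasurePreserving_snd
  calc ∫⁻ x, (∫⁻ t, ENNReal.ofReal (ker (x - t)) * v t ∂vol) ^ (2 : ℝ) ∂vol
      ≤ ∫⁻ x, kerMass * ∫⁻ t, ENNReal.ofReal (ker (x - t)) * v t ^ (2 : ℝ) ∂vol ∂vol := by
        refine lintegral_mono_ae ?_
        filter_upwards [ae_restrict_mem measurableSet_Icc] with x hx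
        exact (cauchy_schwarz_ker (aemeasurable_ker x) hv).trans
          (mul_le_mul_left (lintegral_ker_left hx) _)
    _ = kerMass * ∫⁻ x, ∫⁻ t, ENNReal.ofReal (ker (x - t)) * v t ^ (2 : ℝ) ∂vol ∂vol :=
        lintegral_const_mul' _ _ kerMass_lt_top.ne
    _ = kerMass * ∫⁻ t, ∫⁻ x, ENNReal.ofReal (ker (x - t)) * v t ^ (2 : ℝ) ∂vol ∂vol := by
        rw [lintegral_lintegral_swap hmeas]
    _ ≤ kerMass * ∫⁻ t, kerMass * v t ^ (2 : ℝ) ∂vol := by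
        refine mul_le_mul_right (lintegral_mono_ae ?_) _
        filter_upwards [ae_restrict_mem measurableSet_Icc] with t ht
        have hk : Measurable fun x : ℝ => ENNReal.ofReal (ker (x - t)) :=
          (measurable_ker.comp (measurable_id.sub measurable_const)).ennreal_ofReal
        rw [lintegral_mul_const _ hk]
        exact mul_le_mul_left (lintegral_ker_right ht) _
    _ = kerMass * (kerMass * ∫⁻ t, v t ^ (2 : ℝ) ∂vol) := by
        rw [lintegral_const_mul' _ _ kerMass_lt_top.ne]

section HalfIntegral

variable {𝕜 : Type*} [RCLike 𝕜]

theorem enorm_ker_mul (s : ℝ) (z : 𝕜) :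
    ‖((ker s : ℝ) : 𝕜) * z‖ₑ = ENNReal.ofReal (ker s) * ‖z‖ₑ := by
  rw [enorm_mul]
  congr 1
  rw [← ofReal_norm, RCLike.norm_of_nonneg (ker_nonneg s)]

/-- On `[-1,1]` the half-integral is the integral operator with kernel `ker (x - t) / √π`. -/
theorem halfIntegral_eq (u : ℝ → 𝕜) {x : ℝ} (hx : x ∈ Set.Icc (-1 : ℝ) 1) :
    halfIntegral u x
      = ((1 / √Real.pi : ℝ) : 𝕜) * ∫ t, ((ker (x - t) : ℝ) : 𝕜) * u t ∂vol := by
  unfold halfIntegral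
  congr 1
  rw [intervalIntegral.integral_of_le hx.1, ← integral_Icc_eq_integral_Ioc,
    ← integral_indicator measurableSet_Icc, ← integral_indicator measurableSet_Icc]
  congr 1
  funext t
  have hk : u t / ((√(x - t) : ℝ) : 𝕜) = ((ker (x - t) : ℝ) : 𝕜) * u t := by
    simp [ker, div_eq_mul_inv, mul_comm]
  by_cases h1 : t ∈ Set.Icc (-1 : ℝ) x
  · have h2 : t ∈ Set.Icc (-1 : ℝ) 1 := ⟨h1.1, h1.2.trans hx.2⟩
    simp only [Set.indicator, h1, h2, if_true, hk]
  · by_cases h2 : t ∈ Set.Icc (-1 : ℝ) 1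
    · have h3 : x - t ≤ 0 := by
        by_contra h
        exact h1 ⟨h2.1, by linarith⟩
      simp [Set.indicator, h1, ker_of_nonpos h3]
    · simp only [Set.indicator, h1, h2, if_false]

theorem aestronglyMeasurable_halfIntegral {u : ℝ → 𝕜} (hu : AEStronglyMeasurable u vol) :
    AEStronglyMeasurable (halfIntegral u) vol := by
  have h : AEStronglyMeasurable (fun p : ℝ × ℝ => ((ker (p.1 - p.2) : ℝ) : 𝕜) * u p.2)
      (vol.prod vol) := by
    refine AEStronglyMeasurable.mul ?_ hu.comp_snd
    exact (RCLike.measurable_ofReal.comp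
      (measurable_ker.comp (measurable_fst.sub measurable_snd))).aestronglyMeasurable
  refine (h.integral_prod_right'.const_mul ((1 / √Real.pi : ℝ) : 𝕜)).congr ?_
  filter_upwards [ae_restrict_mem measurableSet_Icc] with x hx
  exact (halfIntegral_eq u hx).symm

theorem lintegral_enorm_sq_lt_top {u : ℝ → 𝕜} (hu : MemLp u 2 vol) :
    ∫⁻ t, ‖u t‖ₑ ^ (2 : ℝ) ∂vol < ⊤ := by
  have := (eLpNorm_lt_top_iff_lintegral_rpow_enorm_lt_top (p := 2) (by norm_num)
    (by norm_num)).1 hu.2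
  simpa using this

theorem integrable_ker_mul {u : ℝ → 𝕜} (hu : MemLp u 2 vol) :
    ∀ᵐ x ∂vol, Integrable (fun t => ((ker (x - t) : ℝ) : 𝕜) * u t) vol := by
  have hv : AEMeasurable (fun t => ‖u t‖ₑ) vol := hu.1.enorm
  have h1 := lintegral_sq_le hv
  have h2 : ∫⁻ x, (∫⁻ t, ENNReal.ofReal (ker (x - t)) * ‖u t‖ₑ ∂vol) ^ (2 : ℝ) ∂vol ≠ ⊤ :=
    (h1.trans_lt (ENNReal.mul_lt_top kerMass_lt_top
      (ENNReal.mul_lt_top kerMass_lt_top (lintegral_enorm_sq_lt_top hu)))).ne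
  have hm : AEMeasurable (fun x =>
      (∫⁻ t, ENNReal.ofReal (ker (x - t)) * ‖u t‖ₑ ∂vol) ^ (2 : ℝ)) vol := by
    have hp : AEMeasurable (fun p : ℝ × ℝ => ENNReal.ofReal (ker (p.1 - p.2)) * ‖u p.2‖ₑ)
        (vol.prod vol) := by
      have hk : AEMeasurable (fun p : ℝ × ℝ => ENNReal.ofReal (ker (p.1 - p.2)))
          (vol.prod vol) :=
        (measurable_ker.comp (measurable_fst.sub measurable_snd)).ennreal_ofReal.aemeasurable
      have hw : AEMeasurable (fun p : ℝ × ℝ => ‖u p.2‖ₑ) (vol.prod vol) :=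
        hv.comp_quasiMeasurePreserving Measure.quasiMeasurePreserving_snd
      exact hk.mul hw
    exact hp.lintegral_prod_right'.pow_const 2
  filter_upwards [ae_lt_top' hm h2] with x hx
  refine ⟨?_, ?_⟩
  · have hk : Measurable fun t : ℝ => ((ker (x - t) : ℝ) : 𝕜) :=
      RCLike.measurable_ofReal.comp (measurable_ker.comp (measurable_const.sub measurable_id))
    exact hk.aestronglyMeasurable.mul hu.1
  · unfold HasFiniteIntegral
    simp only [enorm_ker_mul]
    exact (ENNReal.rpow_lt_top_iff_of_pos (by norm_num)).1 hx

/-- The half-integral is bounded on `L²[-1,1]`. -/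
theorem eLpNorm_halfIntegral_le {u : ℝ → 𝕜} (hu : AEStronglyMeasurable u vol) :
    eLpNorm (halfIntegral u) 2 vol
      ≤ ENNReal.ofReal (1 / √Real.pi) * (kerMass * eLpNorm u 2 vol) := by
  have hsq : ∀ w : ℝ → 𝕜, eLpNorm w 2 vol = (∫⁻ x, ‖w x‖ₑ ^ (2 : ℝ) ∂vol) ^ (1 / 2 : ℝ) := by
    intro w
    rw [eLpNorm_eq_lintegral_rpow_enorm_toReal (by norm_num) (by norm_num)]
    simp
  have hle : eLpNorm (fun x => ∫ t, ((ker (x - t) : ℝ) : 𝕜) * u t ∂vol) 2 vol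
      ≤ kerMass * eLpNorm u 2 vol := by
    rw [hsq, hsq]
    have h0 : ∫⁻ x, ‖∫ t, ((ker (x - t) : ℝ) : 𝕜) * u t ∂vol‖ₑ ^ (2 : ℝ) ∂vol
        ≤ kerMass * (kerMass * ∫⁻ t, ‖u t‖ₑ ^ (2 : ℝ) ∂vol) := by
      refine (lintegral_mono fun x => ?_).trans (lintegral_sq_le hu.enorm)
      refine ENNReal.rpow_le_rpow ?_ (by norm_num)
      refine (enorm_integral_le_lintegral_enorm _).trans (le_of_eq ?_)
      simp only [enorm_ker_mul]
    refine (ENNReal.rpow_le_rpow h0 (by norm_num)).trans (le_of_eq ?_)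
    rw [← mul_assoc, ENNReal.mul_rpow_of_nonneg _ _ (by norm_num),
      ENNReal.mul_rpow_of_nonneg _ _ (by norm_num),
      ← ENNReal.rpow_add_of_nonneg _ _ (by norm_num) (by norm_num)]
    norm_num
  have hcongr : eLpNorm (halfIntegral u) 2 vol
      = eLpNorm (((1 / √Real.pi : ℝ) : 𝕜) •
          fun x => ∫ t, ((ker (x - t) : ℝ) : 𝕜) * u t ∂vol) 2 vol := by
    refine eLpNorm_congr_ae ?_
    filter_upwards [ae_restrict_mem measurableSet_Icc] with x hx
    exact halfIntegral_eq u hx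
  rw [hcongr, eLpNorm_const_smul]
  have : ‖((1 / √Real.pi : ℝ) : 𝕜)‖ₑ = ENNReal.ofReal (1 / √Real.pi) := by
    rw [← ofReal_norm, RCLike.norm_of_nonneg (by positivity)]
  rw [this]
  exact mul_le_mul_right hle _

theorem memLp_halfIntegral {u : ℝ → 𝕜} (hu : MemLp u 2 vol) :
    MemLp (halfIntegral u) 2 vol :=
  ⟨aestronglyMeasurable_halfIntegral hu.1,
    (eLpNorm_halfIntegral_le hu.1).trans_lt (ENNReal.mul_lt_top ENNReal.ofReal_lt_top
      (ENNReal.mul_lt_top kerMass_lt_top hu.2))⟩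

theorem halfIntegral_congr {u v : ℝ → 𝕜} (h : u =ᵐ[vol] v) {x : ℝ}
    (hx : x ∈ Set.Icc (-1 : ℝ) 1) : halfIntegral u x = halfIntegral v x := by
  rw [halfIntegral_eq u hx, halfIntegral_eq v hx]
  congr 1
  refine integral_congr_ae ?_
  filter_upwards [h] with t ht
  rw [ht]

variable (𝕜) in
/-- The half-integral as a bounded linear operator on `L²[-1,1]`. -/
noncomputable def halfIntegralL2 : L2 𝕜 →L[𝕜] L2 𝕜 :=
  LinearMap.mkContinuousOfExistsBound
    { toFun := fun u => (memLp_halfIntegral (Lp.memLp u)).toLp (halfIntegral u)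
      map_add' := by
        intro u v
        rw [← MemLp.toLp_add]
        refine MemLp.toLp_congr _ _ ?_
        filter_upwards [ae_restrict_mem measurableSet_Icc, integrable_ker_mul (Lp.memLp u),
          integrable_ker_mul (Lp.memLp v)] with x hx hu hv
        rw [Pi.add_apply, halfIntegral_congr (Lp.coeFn_add u v) hx, halfIntegral_eq _ hx,
          halfIntegral_eq _ hx, halfIntegral_eq _ hx, ← mul_add, ← integral_add hu hv]
        simp only [Pi.add_apply, mul_add]
      map_smul' := by
        intro c u
        rw [RingHom.id_apply, ← MemLp.toLp_const_smul]
        refine MemLp.toLp_congr _ _ ?_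
        filter_upwards [ae_restrict_mem measurableSet_Icc] with x hx
        rw [Pi.smul_apply, halfIntegral_congr (Lp.coeFn_smul c u) hx, halfIntegral_eq _ hx,
          halfIntegral_eq _ hx, smul_eq_mul, mul_left_comm c, ← integral_const_mul c]
        simp only [Pi.smul_apply, smul_eq_mul, mul_left_comm c] }
    ⟨(ENNReal.ofReal (1 / √Real.pi) * kerMass).toReal, fun u => by
      simp only [LinearMap.coe_mk, AddHom.coe_mk]
      rw [Lp.norm_toLp, Lp.norm_def, ← ENNReal.toReal_mul, mul_assoc]
      exact ENNReal.toReal_mono (ENNReal.mul_lt_top ENNReal.ofReal_lt_top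
        (ENNReal.mul_lt_top kerMass_lt_top (Lp.memLp u).2)).ne
        (eLpNorm_halfIntegral_le (Lp.memLp u).1)⟩

theorem halfIntegralL2_ae (u : L2 𝕜) :
    (halfIntegralL2 𝕜 u : ℝ → 𝕜) =ᵐ[vol] halfIntegral u :=
  MemLp.coeFn_toLp (memLp_halfIntegral (Lp.memLp u))

end HalfIntegral

/-! ### The two polynomial bases -/

/-- The Legendre polynomials `P_n`. -/
noncomputable def legendre : ℕ → Polynomial ℝ
  | 0 => 1
  | 1 => Polynomial.X
  | n + 2 => Polynomial.C (1 / ((n : ℝ) + 2)) *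
      (Polynomial.C (2 * (n : ℝ) + 3) * Polynomial.X * legendre (n + 1)
        - Polynomial.C ((n : ℝ) + 1) * legendre n)

/-- The function `P_n`. -/
noncomputable def P (n : ℕ) (x : ℝ) : ℝ := (legendre n).eval x

/-- The function `U_n`, the Chebyshev polynomial of the second kind. -/
noncomputable def U (n : ℕ) (x : ℝ) : ℝ := (Polynomial.Chebyshev.U ℝ (n : ℤ)).eval x

/-! ### The infinite system and its finite sections -/

/-- The matrix of the half-integral from the basis `P_n` to the basis `√(1+x) U_n`,
`Q^{1/2} P_n = 2/(√π (2n+1)) √(1+x) (U_n - U_{n-1})`; the column index is `n`. -/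
noncomputable def QP : Matrix ℕ ℕ ℝ := fun k n =>
  2 / √Real.pi *
    (if k = n then 1 / (2 * (n : ℝ) + 1) else if k + 1 = n then -(1 / (2 * (n : ℝ) + 1)) else 0)

/-- The matrix of the half-integral from the basis `√(1+x) U_n` to the basis `P_n`,
`Q^{1/2} (√(1+x) U_n) = (√π/2) (P_n + P_{n+1})`; the column index is `n`. -/
noncomputable def QU : Matrix ℕ ℕ ℝ := fun k n =>
  √Real.pi / 2 * (if k = n then 1 else if k = n + 1 then 1 else 0)

section System

variable {𝕜 : Type*} [RCLike 𝕜]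

/-- The matrix `σ I + Q^{1/2}` of the infinite banded system, acting on the pair of coefficient
sequences with respect to the bases `P_n` and `√(1+x) U_n`. -/
noncomputable def systemMatrix (σ : 𝕜) : Matrix (ℕ ⊕ ℕ) (ℕ ⊕ ℕ) 𝕜 :=
  Matrix.fromBlocks (σ • 1) (QU.map (fun r : ℝ => (r : 𝕜)))
    (QP.map (fun r : ℝ => (r : 𝕜))) (σ • 1)

/-- The `2N × 2N` finite section of the infinite system. -/
noncomputable def finiteSection (σ : 𝕜) (N : ℕ) : Matrix (Fin N ⊕ Fin N) (Fin N ⊕ Fin N) 𝕜 :=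
  (systemMatrix σ).submatrix (Sum.map (fun i => (i : ℕ)) (fun i => (i : ℕ)))
    (Sum.map (fun i => (i : ℕ)) (fun i => (i : ℕ)))

/-- The truncated right-hand side `(P_N e, P_N f)`. -/
def truncatedRhs (e f : ℕ → 𝕜) (N : ℕ) : Fin N ⊕ Fin N → 𝕜 :=
  Sum.elim (fun i => e i) (fun i => f i)

/-- The function `∑_{n<N} a_n P_n(x) + √(1+x) ∑_{n<N} b_n U_n(x)` with coefficients
`c = (a, b)`. -/
noncomputable def expansion {N : ℕ} (c : Fin N ⊕ Fin N → 𝕜) (x : ℝ) : 𝕜 :=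
  ∑ n : Fin N, c (Sum.inl n) * ((P n x : ℝ) : 𝕜)
    + ((√(1 + x) : ℝ) : 𝕜) * ∑ n : Fin N, c (Sum.inr n) * ((U n x : ℝ) : 𝕜)

end System

end HalfOrder

namespace HalfOrder

/-! ### Legendre polynomials -/

section Legendre

open Polynomial

/-! Write A = σI + Q^{1/2}. On the span of the first N elements of both bases, A acts as the finite
section except for one leaked term: `QU` is lower bidiagonal, so √(1+x) U_{N-1} also produces P_N.
Hence A u_N = (truncated right-hand side) + τ_N P_N with τ_N = -(leak)-free residue (√π/2) b_{N,N-1}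
(`apply_expansionL2`). Since ‖P_N‖ → 0, a uniform bound on the coefficients b_{N,n} suffices: A u_N
then converges to the right-hand side, and the bounded inverse of A gives u_N → u. No L² stability
estimate for the sections is needed.

For the bound, first σ ≠ 0: Q^{1/2} applied twice is integration, which sends P_{n+1} to (P_{n+2} -
P_n)/(2n+3), so Q^{1/2} has no bounded inverse. The first block row then eliminates a. With B = (0,
b_0, b_1, …) and d_k = (B_{k+1} + B_k)/(2k+1), what remains is σ² B_{k+1} = d_k - d_{k+1} + data,
with d_N dropped in the last row. The terms d_k are a compact perturbation of σ²I on bounded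
sequences, so a compactness argument (`exists_truncatedResidual_lower_bound`) reduces the bound to
showing that the full homogeneous recurrence has no nonzero bounded solution with B_0 = 0.

That is `eq_zero_of_recurrence`. Such a B is summable. With S = Σ B_n sin nθ and C = Σ d_n
cos((n+1/2)θ), the recurrence says σ² S = 2 sin(θ/2) C, and the definition of d says C' = -cos(θ/2)
S. So C solves a linear first-order equation with C(π) = 0; hence C = 0, S = 0 and B = 0. -/

theorem legendre_recurrence (n : ℕ) :
    ((n : ℝ[X]) + 2) * legendre (n + 2)
      = (2 * (n : ℝ[X]) + 3) * X * legendre (n + 1) - ((n : ℝ[X]) + 1) * legendre n := by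
  have h : ((n : ℝ[X]) + 2) * C (1 / ((n : ℝ) + 2)) = 1 := by
    have h2 : ((n : ℝ[X]) + 2) = C ((n : ℝ) + 2) := by simp [map_ofNat C 2]
    rw [h2, ← C_mul, mul_one_div_cancel (by positivity), C_1]
  rw [legendre, ← mul_assoc, h, one_mul]
  simp [map_ofNat C 2, map_ofNat C 3]

/-- The two identities are proved together because each inductive step uses both: the differentiated
recurrence and the first identity give the new second one, from which the new first one follows. -/
theorem legendre_derivative_aux (n : ℕ) :
    X * derivative (legendre (n + 1)) - derivative (legendre n)
        = ((n : ℝ[X]) + 1) * legendre (n + 1) ∧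
      derivative (legendre (n + 1)) - X * derivative (legendre n)
        = ((n : ℝ[X]) + 1) * legendre n := by
  induction n with
  | zero => simp [legendre]
  | succ n ih =>
    obtain ⟨hA, hB⟩ := ih
    have hr := legendre_recurrence n
    have hd := congrArg derivative hr
    simp only [derivative_mul, derivative_add, derivative_sub, derivative_natCast,
      derivative_X, derivative_ofNat, derivative_one] at hd
    have hn : ((n : ℝ[X]) + 2) ≠ 0 := by
      have : ((n : ℝ[X]) + 2) = ((n + 2 : ℕ) : ℝ[X]) := by simp
      rw [this]
      exact Nat.cast_ne_zero.2 (by omega)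
    have hB' : derivative (legendre (n + 2)) - X * derivative (legendre (n + 1))
        = ((n : ℝ[X]) + 2) * legendre (n + 1) := by
      refine mul_left_cancel₀ hn ?_
      linear_combination hd + ((n : ℝ[X]) + 1) * hA
    push_cast
    refine ⟨?_, ?_⟩
    · linear_combination X * hB' + X * hA - hB - hr
    · linear_combination hB'

theorem derivative_legendre_sub (n : ℕ) :
    derivative (legendre (n + 2)) - derivative (legendre n)
      = (2 * (n : ℝ[X]) + 3) * legendre (n + 1) := by
  have h1 := (legendre_derivative_aux n).1
  have h2 := (legendre_derivative_aux (n + 1)).2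
  push_cast at h2
  linear_combination h1 + h2

theorem P_recurrence (n : ℕ) (x : ℝ) :
    ((n : ℝ) + 2) * P (n + 2) x = (2 * (n : ℝ) + 3) * x * P (n + 1) x - ((n : ℝ) + 1) * P n x := by
  simpa [P] using congrArg (eval x) (legendre_recurrence n)

theorem P_zero (x : ℝ) : P 0 x = 1 := by simp [P, legendre]

theorem P_one (x : ℝ) : P 1 x = x := by simp [P, legendre]

theorem P_at_one (n : ℕ) : P n 1 = 1 := by
  induction n using Nat.twoStepInduction with
  | zero => exact P_zero 1
  | one => exact P_one 1
  | more n h0 h1 =>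
    have h := P_recurrence n 1
    rw [h0, h1] at h
    have hn : ((n : ℝ) + 2) ≠ 0 := by positivity
    refine mul_left_cancel₀ hn ?_
    linarith

theorem P_at_neg_one (n : ℕ) : P n (-1) = (-1) ^ n := by
  induction n using Nat.twoStepInduction with
  | zero => simp [P_zero]
  | one => simp [P_one]
  | more n h0 h1 =>
    have h := P_recurrence n (-1)
    rw [h0, h1] at h
    have hn : ((n : ℝ) + 2) ≠ 0 := by positivity
    refine mul_left_cancel₀ hn ?_
    rw [h]
    ring

theorem natDegree_legendre_le (n : ℕ) : (legendre n).natDegree ≤ n := by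
  induction n using Nat.twoStepInduction with
  | zero => simp [legendre]
  | one => simp [legendre]
  | more n h0 h1 =>
    rw [legendre]
    refine (natDegree_C_mul_le _ _).trans ((natDegree_sub_le _ _).trans (max_le ?_ ?_))
    · refine natDegree_mul_le.trans ?_
      have := natDegree_C_mul_le (2 * (n : ℝ) + 3) (X : ℝ[X])
      rw [natDegree_X] at this
      omega
    · exact (natDegree_C_mul_le _ _).trans (by omega)

theorem continuous_P (n : ℕ) : Continuous (P n) := (legendre n).continuous

theorem continuous_U (n : ℕ) : Continuous (U n) := (Chebyshev.U ℝ (n : ℤ)).continuous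

theorem hasDerivAt_P_sub (n : ℕ) (x : ℝ) :
    HasDerivAt (fun x => P (n + 2) x - P n x) ((2 * (n : ℝ) + 3) * P (n + 1) x) x := by
  have h := congrArg (eval x) (derivative_legendre_sub n)
  simp only [eval_sub, eval_mul, eval_add, eval_ofNat, eval_natCast] at h
  unfold P
  rw [← h]
  exact ((legendre (n + 2)).hasDerivAt x).sub ((legendre n).hasDerivAt x)

theorem hasDerivAt_P (n : ℕ) (x : ℝ) :
    HasDerivAt (P n) (eval x (derivative (legendre n))) x :=
  (legendre n).hasDerivAt x

/-- `P_n` is orthogonal to the polynomials of degree less than `n`. -/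
theorem integral_P_mul_eq_zero (d : ℕ) (p : ℝ[X]) (hp : p.natDegree ≤ d) (n : ℕ) (hn : d < n) :
    ∫ x in (-1 : ℝ)..1, P n x * p.eval x = 0 := by
  induction d generalizing p n with
  | zero =>
    obtain ⟨c, rfl⟩ := natDegree_eq_zero.1 (Nat.le_zero.1 hp)
    obtain ⟨m, rfl⟩ : ∃ m, n = m + 1 := ⟨n - 1, by omega⟩
    simp only [eval_C, intervalIntegral.integral_mul_const]
    have h := intervalIntegral.integral_eq_sub_of_hasDerivAt (a := -1) (b := 1)
      (fun x _ => hasDerivAt_P_sub m x)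
      ((continuous_const.mul (continuous_P (m + 1))).intervalIntegrable _ _)
    rw [intervalIntegral.integral_const_mul] at h
    simp only [P_at_one, P_at_neg_one, pow_add] at h
    have hm : (2 * (m : ℝ) + 3) ≠ 0 := by positivity
    have : ∫ x in (-1 : ℝ)..1, P (m + 1) x = 0 := by
      refine mul_left_cancel₀ hm ?_
      rw [h]; ring
    rw [this, zero_mul]
  | succ d ih =>
    obtain ⟨m, rfl⟩ : ∃ m, n = m + 1 := ⟨n - 1, by omega⟩
    have hd : (derivative p).natDegree ≤ d := (natDegree_derivative_le p).trans (by omega)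
    have h1 := ih (derivative p) hd (m + 2) (by omega)
    have h2 := ih (derivative p) hd m (by omega)
    -- The antiderivative P_{m+2} - P_m of (2m+3) P_{m+1} vanishes at ±1, so integration by parts
    -- has no boundary term and lowers the degree of p.
    have hparts := intervalIntegral.integral_deriv_mul_eq_sub (a := -1) (b := 1)
      (fun x _ => hasDerivAt_P_sub m x) (fun x _ => p.hasDerivAt x)
      ((continuous_const.mul (continuous_P (m + 1))).intervalIntegrable _ _)
      ((derivative p).continuous.intervalIntegrable _ _)
    have e : ∀ x, (2 * (m : ℝ) + 3) * P (m + 1) x * eval x p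
        + (P (m + 2) x - P m x) * eval x (derivative p)
        = (2 * (m : ℝ) + 3) * (P (m + 1) x * eval x p)
          + (P (m + 2) x * eval x (derivative p) - P m x * eval x (derivative p)) :=
      fun x => by ring
    have c1 : ∀ k (q : ℝ[X]), IntervalIntegrable (fun x => P k x * eval x q) volume (-1) 1 :=
      fun k q => ((continuous_P k).mul q.continuous).intervalIntegrable _ _
    simp only [e] at hparts
    rw [intervalIntegral.integral_add ((c1 _ _).const_mul _) ((c1 _ _).sub (c1 _ _)),
      intervalIntegral.integral_sub (c1 _ _) (c1 _ _), h1, h2,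
      intervalIntegral.integral_const_mul] at hparts
    simp only [P_at_one, P_at_neg_one, pow_add] at hparts
    have hm : (2 * (m : ℝ) + 3) ≠ 0 := by positivity
    refine mul_left_cancel₀ hm ?_
    linarith

/-- Integrate the derivative of x P_{n+1}², whose boundary values contribute 2. Since x P_{n+1}' =
P_n' + (n+1) P_{n+1} and P_n' is orthogonal to P_{n+1}, only (2n+3) ∫ P_{n+1}² is left. -/
theorem integral_P_sq (n : ℕ) : ∫ x in (-1 : ℝ)..1, P n x ^ 2 = 2 / (2 * (n : ℝ) + 1) := by
  rcases n with _ | n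
  · norm_num [P_zero]
  · have hc := continuous_P (n + 1)
    have hparts := intervalIntegral.integral_deriv_mul_eq_sub (a := -1) (b := 1)
      (u := fun x => x * P (n + 1) x) (v := P (n + 1))
      (u' := fun x => P (n + 1) x + x * eval x (derivative (legendre (n + 1))))
      (fun x _ => by
        simpa using (hasDerivAt_id x).fun_mul (hasDerivAt_P (n + 1) x))
      (fun x _ => hasDerivAt_P (n + 1) x)
      (Continuous.intervalIntegrable (by fun_prop) _ _)
      (Continuous.intervalIntegrable (by fun_prop) _ _)
    have h0 : ∫ x in (-1 : ℝ)..1, P (n + 1) x * eval x (derivative (legendre n)) = 0 :=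
      integral_P_mul_eq_zero n _ ((natDegree_derivative_le _).trans
        ((Nat.sub_le _ _).trans (natDegree_legendre_le n))) _ (Nat.lt_succ_self n)
    have hA : ∀ x, x * eval x (derivative (legendre (n + 1)))
        = eval x (derivative (legendre n)) + ((n : ℝ) + 1) * P (n + 1) x := by
      intro x
      have h := congrArg (eval x) (legendre_derivative_aux n).1
      simp only [eval_sub, eval_mul, eval_add, eval_X, eval_natCast, eval_one] at h
      unfold P
      linarith
    have e : ∀ x, (P (n + 1) x + x * eval x (derivative (legendre (n + 1))))
            * P (n + 1) x
          + x * P (n + 1) x * eval x (derivative (legendre (n + 1)))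
        = (2 * (n : ℝ) + 3) * P (n + 1) x ^ 2
          + 2 * (P (n + 1) x * eval x (derivative (legendre n))) := by
      intro x
      have := hA x
      linear_combination 2 * P (n + 1) x * this
    rw [intervalIntegral.integral_congr (fun x _ => e x),
      intervalIntegral.integral_add (Continuous.intervalIntegrable (by fun_prop) _ _)
        (Continuous.intervalIntegrable (by fun_prop) _ _),
      intervalIntegral.integral_const_mul, intervalIntegral.integral_const_mul, h0] at hparts
    simp only [P_at_one, P_at_neg_one] at hparts
    have h1 : ((-1 : ℝ) ^ (n + 1)) * (-1) ^ (n + 1) = 1 := by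
      rw [← mul_pow]; norm_num
    rw [eq_div_iff (by positivity)]
    push_cast
    linarith

end Legendre

/-! ### Half-integrals of polynomials -/

theorem integral_rpow_mul_rpow {s r a : ℝ} (hs : 0 < s) (hr : 0 < r) (ha : 0 < a) :
    ∫ t in (0 : ℝ)..a, t ^ (s - 1) * (a - t) ^ (r - 1)
      = a ^ (s + r - 1) * ProbabilityTheory.beta s r := by
  have h := Complex.betaIntegral_scaled (s : ℂ) (r : ℂ) ha
  have hb : Complex.betaIntegral s r = ((ProbabilityTheory.beta s r : ℝ) : ℂ) := by
    rw [Complex.betaIntegral_eq_Gamma_mul_div s r (by simpa) (by simpa), ProbabilityTheory.beta]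
    push_cast [← Complex.Gamma_ofReal]
    rfl
  have hi : ∫ t in (0 : ℝ)..a, (t : ℂ) ^ ((s : ℂ) - 1) * ((a : ℂ) - t) ^ ((r : ℂ) - 1)
      = ∫ t in (0 : ℝ)..a, ((t ^ (s - 1) * (a - t) ^ (r - 1) : ℝ) : ℂ) := by
    refine intervalIntegral.integral_congr fun t ht => ?_
    rw [Set.uIcc_of_le ha.le] at ht
    rw [Complex.ofReal_mul, Complex.ofReal_cpow ht.1, Complex.ofReal_cpow (by linarith [ht.2])]
    push_cast
    rfl
  rw [hi, hb, intervalIntegral.integral_ofReal] at h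
  have : ((a : ℂ) ^ ((s : ℂ) + r - 1)) = ((a ^ (s + r - 1) : ℝ) : ℂ) := by
    rw [Complex.ofReal_cpow ha.le]; push_cast; rfl
  rw [this] at h
  exact_mod_cast h

theorem halfIntegral_neg_one {𝕜 : Type*} [RCLike 𝕜] (u : ℝ → 𝕜) : halfIntegral u (-1) = 0 := by
  simp [halfIntegral]

theorem halfIntegral_rpow {s x : ℝ} (hs : 0 < s) (hx : -1 < x) :
    halfIntegral (fun t => (1 + t) ^ (s - 1)) x
      = (1 / √Real.pi) * ((1 + x) ^ (s - 1 / 2) * ProbabilityTheory.beta s (1 / 2)) := by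
  have h := integral_rpow_mul_rpow (a := 1 + x) hs (show (0 : ℝ) < 1 / 2 by norm_num) (by linarith)
  have e : s + 1 / 2 - 1 = s - 1 / 2 := by ring
  rw [e] at h
  rw [halfIntegral, ← h]
  simp only [RCLike.ofReal_real_eq_id, id]
  congr 1
  have h2 := intervalIntegral.integral_comp_add_left (a := -1) (b := x)
    (fun t => t ^ (s - 1) * (1 + x - t) ^ ((1 : ℝ) / 2 - 1)) 1
  simp only [add_neg_cancel] at h2
  rw [← h2]
  refine intervalIntegral.integral_congr fun t ht => ?_
  rw [Set.uIcc_of_le hx.le] at ht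
  have : 1 + x - (1 + t) = x - t := by ring
  rw [this, show (1 : ℝ) / 2 - 1 = -(1 / 2) by norm_num, Real.rpow_neg (by linarith [ht.2]),
    ← Real.sqrt_eq_rpow, div_eq_mul_inv]

theorem beta_succ_half {s : ℝ} (hs : 0 < s) :
    ProbabilityTheory.beta (s + 1) (1 / 2) * (2 * s + 1)
      = ProbabilityTheory.beta s (1 / 2) * (2 * s) := by
  unfold ProbabilityTheory.beta
  rw [Real.Gamma_add_one hs.ne', show s + 1 + 1 / 2 = (s + 1 / 2) + 1 by ring,
    Real.Gamma_add_one (by linarith)]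
  have := (Real.Gamma_pos_of_pos (show 0 < s + 1 / 2 by linarith)).ne'
  field_simp

/-- The factors Γ(s+1/2) cancel and Γ(1/2)² = π. This is the semigroup law on powers: two
half-integrations of (1+t)^{s-1} give (1+x)^s / s. -/
theorem beta_half_mul_beta_half {s : ℝ} (hs : 0 < s) :
    ProbabilityTheory.beta s (1 / 2) * ProbabilityTheory.beta (s + 1 / 2) (1 / 2)
      = Real.pi / s := by
  unfold ProbabilityTheory.beta
  rw [show s + 1 / 2 + 1 / 2 = s + 1 by ring, Real.Gamma_add_one hs.ne',
    Real.Gamma_one_half_eq]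
  have h1 := (Real.Gamma_pos_of_pos (show 0 < s + 1 / 2 by linarith)).ne'
  have h2 := (Real.Gamma_pos_of_pos hs).ne'
  field_simp
  exact Real.sq_sqrt Real.pi_pos.le

theorem intervalIntegrable_div_sqrt {u : ℝ → ℝ} (hu : Continuous u) {x : ℝ}
    (hx : -1 ≤ x) : IntervalIntegrable (fun t => u t / √(x - t)) volume (-1) x := by
  have h : IntervalIntegrable (fun s : ℝ => s ^ (-(1 / 2) : ℝ)) volume (x + 1) 0 :=
    intervalIntegral.intervalIntegrable_rpow' (by norm_num)
  have h2 := h.comp_sub_left x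
  simp only [sub_add_cancel_left, sub_zero] at h2
  have h3 := h2.continuousOn_mul hu.continuousOn
  refine h3.congr_uIoo fun t ht => ?_
  rw [Set.uIoo_of_le hx] at ht
  simp only
  rw [Real.rpow_neg (by linarith [ht.2]), ← Real.sqrt_eq_rpow, div_eq_mul_inv]

theorem halfIntegral_const_mul (c : ℝ) (u : ℝ → ℝ) (x : ℝ) :
    halfIntegral (fun t => c * u t) x = c * halfIntegral u x := by
  simp only [halfIntegral, mul_div_assoc, intervalIntegral.integral_const_mul]
  ring

theorem halfIntegral_add {u v : ℝ → ℝ} (hu : Continuous u) (hv : Continuous v) {x : ℝ}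
    (hx : -1 ≤ x) :
    halfIntegral (fun t => u t + v t) x = halfIntegral u x + halfIntegral v x := by
  simp only [halfIntegral, add_div]
  rw [intervalIntegral.integral_add]
  · ring
  · exact intervalIntegrable_div_sqrt hu hx
  · exact intervalIntegrable_div_sqrt hv hx

theorem halfIntegral_sub {u v : ℝ → ℝ} (hu : Continuous u) (hv : Continuous v) {x : ℝ}
    (hx : -1 ≤ x) :
    halfIntegral (fun t => u t - v t) x = halfIntegral u x - halfIntegral v x := by
  simp only [sub_eq_add_neg, ← neg_one_mul (v _)]
  rw [halfIntegral_add hu (by fun_prop) hx, halfIntegral_const_mul]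
  ring

theorem halfIntegral_congr_of_le {𝕜 : Type*} [RCLike 𝕜] {u v : ℝ → 𝕜} {x : ℝ} (hx : -1 ≤ x)
    (h : ∀ t, -1 ≤ t → u t = v t) : halfIntegral u x = halfIntegral v x := by
  unfold halfIntegral
  congr 1
  refine intervalIntegral.integral_congr fun t ht => ?_
  rw [Set.uIcc_of_le hx] at ht
  simp only [h t ht.1]

theorem halfIntegral_ofReal {𝕜 : Type*} [RCLike 𝕜] (u : ℝ → ℝ) (x : ℝ) :
    halfIntegral (fun t => ((u t : ℝ) : 𝕜)) x = ((halfIntegral u x : ℝ) : 𝕜) := by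
  simp only [halfIntegral, ← RCLike.ofReal_div, RCLike.intervalIntegral_ofReal]
  simp

/-- The factor in the half-integral of `(1 + t) ^ k`. -/
noncomputable def halfIntegralCoeff (k : ℕ) : ℝ :=
  1 / √Real.pi * ProbabilityTheory.beta ((k : ℝ) + 1) (1 / 2)

theorem halfIntegralCoeff_succ (k : ℕ) :
    halfIntegralCoeff (k + 1) * (2 * (k : ℝ) + 3) = halfIntegralCoeff k * (2 * (k : ℝ) + 2) := by
  have h := beta_succ_half (show (0 : ℝ) < (k : ℝ) + 1 by positivity)
  simp only [halfIntegralCoeff]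
  push_cast
  linear_combination (1 / √Real.pi) * h

theorem halfIntegralCoeff_zero : halfIntegralCoeff 0 = 2 / √Real.pi := by
  have h : Real.Gamma (3 / 2) = 1 / 2 * √Real.pi := by
    rw [show (3 : ℝ) / 2 = 1 / 2 + 1 by norm_num, Real.Gamma_add_one (by norm_num),
      Real.Gamma_one_half_eq]
  have hp : √Real.pi ≠ 0 := (Real.sqrt_pos.2 Real.pi_pos).ne'
  simp only [halfIntegralCoeff, ProbabilityTheory.beta, Nat.cast_zero, zero_add,
    Real.Gamma_one, Real.Gamma_one_half_eq]
  rw [show (1 : ℝ) + 1 / 2 = 3 / 2 by norm_num, h]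
  field_simp

theorem halfIntegral_one_add_pow (k : ℕ) {x : ℝ} (hx : -1 ≤ x) :
    halfIntegral (fun t => (1 + t) ^ k) x = √(1 + x) * (halfIntegralCoeff k * (1 + x) ^ k) := by
  rcases hx.eq_or_lt with rfl | hx
  · simp [halfIntegral_neg_one]
  · have h := halfIntegral_rpow (s := (k : ℝ) + 1) (by positivity) hx
    simp only [add_sub_cancel_right, Real.rpow_natCast] at h
    rw [h, show (k : ℝ) + 1 - 1 / 2 = 1 / 2 + k by ring, Real.rpow_add (by linarith),
      Real.rpow_natCast, ← Real.sqrt_eq_rpow, halfIntegralCoeff]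
    ring

theorem halfIntegral_sqrt_mul_one_add_pow (k : ℕ) {x : ℝ} (hx : -1 ≤ x) :
    halfIntegral (fun t => √(1 + t) * (halfIntegralCoeff k * (1 + t) ^ k)) x
      = (1 + x) ^ (k + 1) / ((k : ℝ) + 1) := by
  rcases hx.eq_or_lt with rfl | hx
  · simp [halfIntegral_neg_one]
  · have h := halfIntegral_rpow (s := (k : ℝ) + 1 + 1 / 2) (by positivity) hx
    have e : halfIntegral (fun t => √(1 + t) * (halfIntegralCoeff k * (1 + t) ^ k)) x
        = halfIntegral (fun t => halfIntegralCoeff k * (1 + t) ^ ((k : ℝ) + 1 + 1 / 2 - 1)) x := by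
      refine halfIntegral_congr_of_le hx.le fun t ht => ?_
      rw [show (k : ℝ) + 1 + 1 / 2 - 1 = 1 / 2 + k by ring,
        Real.rpow_add_of_nonneg (by linarith) (by positivity) (by positivity),
        Real.rpow_natCast, ← Real.sqrt_eq_rpow]
      ring
    have hb := beta_half_mul_beta_half (show (0 : ℝ) < (k : ℝ) + 1 by positivity)
    have hp : √Real.pi ^ 2 = Real.pi := Real.sq_sqrt Real.pi_pos.le
    have hp0 : √Real.pi ≠ 0 := (Real.sqrt_pos.2 Real.pi_pos).ne'
    have e2 : (1 + x) ^ ((k : ℝ) + 1 + 1 / 2 - 1 / 2) = (1 + x) ^ (k + 1) := by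
      rw [add_sub_cancel_right]
      exact_mod_cast Real.rpow_natCast (1 + x) (k + 1)
    rw [e, halfIntegral_const_mul, h, halfIntegralCoeff, e2]
    rw [eq_div_iff (by positivity)] at hb ⊢
    generalize ProbabilityTheory.beta ((k : ℝ) + 1 + 1 / 2) (1 / 2) = b at hb ⊢
    generalize ProbabilityTheory.beta ((k : ℝ) + 1) (1 / 2) = b' at hb ⊢
    field_simp
    rw [hp]
    linear_combination ((1 + x) ^ (k + 1)) * hb

/-! ### Half-integrals of the two bases, by expansion in powers of 1 + x -/

section Polynomial

open Polynomial

theorem polynomial_induction_one_add {p : ℝ[X] → Prop}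
    (add : ∀ f g, p f → p g → p (f + g)) (pow : ∀ a k, p (C a * (1 + X) ^ k)) (f : ℝ[X]) : p f := by
  have h : ∀ g : ℝ[X], p (g.comp (1 + X)) := fun g => by
    induction g using Polynomial.induction_on' with
    | add g₁ g₂ h₁ h₂ => rw [add_comp]; exact add _ _ h₁ h₂
    | monomial n a => rw [← C_mul_X_pow_eq_monomial]; simpa using pow a n
  have := h (f.comp (X - 1))
  rwa [comp_assoc, show (X - 1 : ℝ[X]).comp (1 + X) = X by simp, comp_X] at this

/-- The half-integral and multiplication by the variable. -/
theorem halfIntegral_mul_derivative (R : ℝ[X]) {x : ℝ} (hx : -1 ≤ x) :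
    halfIntegral (fun t => t * eval t (derivative R)) x
      = x * halfIntegral (fun t => eval t (derivative R)) x
        - 1 / 2 * halfIntegral (fun t => eval t R - eval (-1) R) x := by
  induction R using polynomial_induction_one_add with
  | add f g hf hg =>
    have e1 : ∀ t, t * eval t (derivative (f + g))
        = t * eval t (derivative f) + t * eval t (derivative g) := fun t => by
      simp [mul_add]
    have e2 : ∀ t, eval t (f + g) - eval (-1) (f + g)
        = (eval t f - eval (-1) f) + (eval t g - eval (-1) g) := fun t => by
      simp only [eval_add]; ring
    simp only [e1, e2]
    simp only [derivative_add, eval_add]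
    rw [halfIntegral_add (by fun_prop) (by fun_prop) hx,
      halfIntegral_add (by fun_prop) (by fun_prop) hx,
      halfIntegral_add (by fun_prop) (by fun_prop) hx, hf, hg]
    ring
  | pow a k =>
    rcases k with _ | k
    · simp [halfIntegral]
    · have e1 : ∀ t, t * eval t (derivative (C a * (1 + X) ^ (k + 1)))
          = a * ((k : ℝ) + 1) * ((1 + t) ^ (k + 1) - (1 + t) ^ k) := fun t => by
        simp [derivative_pow]; ring
      have e2 : ∀ t, eval t (derivative (C a * (1 + X) ^ (k + 1)))
          = a * ((k : ℝ) + 1) * (1 + t) ^ k := fun t => by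
        simp [derivative_pow]; ring
      have e3 : ∀ t, eval t (C a * (1 + X) ^ (k + 1)) - eval (-1) (C a * (1 + X) ^ (k + 1))
          = a * (1 + t) ^ (k + 1) := fun t => by
        simp
      simp only [e1]
      simp only [e2, e3, halfIntegral_const_mul]
      rw [halfIntegral_sub (by fun_prop) (by fun_prop) hx, halfIntegral_one_add_pow _ hx,
        halfIntegral_one_add_pow _ hx]
      -- On a power of 1 + t the identity is just the ratio of consecutive beta factors.
      have h := halfIntegralCoeff_succ k
      linear_combination (1 / 2) * a * √(1 + x) * (1 + x) ^ (k + 1) * h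

/-- The semigroup law is checked on powers of 1 + t, which avoids Fubini. The polynomial S makes the
intermediate half-integral explicit, and both identities are additive in the pair (R, S). -/
theorem exists_halfIntegral_derivative (R : ℝ[X]) : ∃ S : ℝ[X], ∀ x, -1 ≤ x →
    halfIntegral (fun t => eval t (derivative R)) x = √(1 + x) * eval x S ∧
      halfIntegral (fun t => √(1 + t) * eval t S) x = eval x R - eval (-1) R := by
  induction R using polynomial_induction_one_add with
  | add f g hf hg =>
    obtain ⟨S, hS⟩ := hf
    obtain ⟨T, hT⟩ := hg
    refine ⟨S + T, fun x hx => ⟨?_, ?_⟩⟩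
    · simp only [derivative_add, eval_add]
      rw [halfIntegral_add (by fun_prop) (by fun_prop) hx, (hS x hx).1, (hT x hx).1]
      ring
    · simp only [eval_add, mul_add]
      rw [halfIntegral_add (by fun_prop) (by fun_prop) hx, (hS x hx).2, (hT x hx).2]
      ring
  | pow a k =>
    rcases k with _ | k
    · exact ⟨0, fun x hx => by simp [halfIntegral]⟩
    · refine ⟨C (a * ((k : ℝ) + 1)) * (C (halfIntegralCoeff k) * (1 + X) ^ k), fun x hx => ⟨?_, ?_⟩⟩
      · have e2 : ∀ t, eval t (derivative (C a * (1 + X) ^ (k + 1)))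
            = a * ((k : ℝ) + 1) * (1 + t) ^ k := fun t => by
          simp [derivative_pow]; ring
        simp only [e2, halfIntegral_const_mul, halfIntegral_one_add_pow _ hx]
        simp
        ring
      · simp only [eval_mul, eval_C, eval_pow, eval_add, eval_one, eval_X,
          mul_left_comm (√_) (a * ((k : ℝ) + 1)) _, halfIntegral_const_mul,
          halfIntegral_sqrt_mul_one_add_pow _ hx]
        have : ((k : ℝ) + 1) ≠ 0 := by positivity
        field_simp
        ring

/-- The half-integral applied twice is integration. -/
theorem halfIntegral_halfIntegral_derivative (R : ℝ[X]) {g : ℝ → ℝ}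
    (hg : ∀ x, -1 ≤ x → halfIntegral (fun t => eval t (derivative R)) x = g x)
    {x : ℝ} (hx : -1 ≤ x) : halfIntegral g x = eval x R - eval (-1) R := by
  obtain ⟨S, hS⟩ := exists_halfIntegral_derivative R
  rw [← (hS x hx).2]
  exact halfIntegral_congr_of_le hx fun t ht => by rw [← hg t ht, (hS t ht).1]

/-- The half-integral of a Legendre polynomial. -/
theorem mul_halfIntegral_P (n : ℕ) {x : ℝ} (hx : -1 ≤ x) :
    (2 * (n : ℝ) + 1) * halfIntegral (P n) x = 2 / √Real.pi *
      (√(1 + x) * (U n x - eval x (Chebyshev.U ℝ ((n : ℤ) - 1)))) := by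
  have h0 : halfIntegral (P 0) x = √(1 + x) * (2 / √Real.pi) := by
    have h := halfIntegral_one_add_pow 0 hx
    simp only [pow_zero, mul_one, halfIntegralCoeff_zero] at h
    rw [← h]
    congr 1
    exact funext P_zero
  induction n using Nat.twoStepInduction with
  | zero =>
    -- The integer index matters here: U_{-1} = 0.
    rw [h0]
    simp [U]
    ring
  | one =>
    have h := halfIntegral_mul_derivative (1 + X) hx
    have e : halfIntegral (fun t => eval t (1 + X) - eval (-1) (1 + X)) x
        = halfIntegral (P 0) x + halfIntegral (P 1) x := by
      rw [← halfIntegral_add (continuous_P 0) (continuous_P 1) hx]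
      congr 1
      funext t
      simp [P_zero, P_one]
    have e1 : (fun t : ℝ => t * eval t (derivative (1 + X))) = P 1 := by
      funext t; simp [P_one]
    have e0 : (fun t : ℝ => eval t (derivative (1 + X))) = P 0 := by
      funext t; simp [P_zero]
    rw [e, e1, e0, h0] at h
    simp [U]
    linear_combination 2 * h
  | more n ih0 ih1 =>
    -- For R = P_{n+2} - P_n one has R(-1) = 0, R' = (2n+3) P_{n+1} and tR' = (n+2) P_{n+2} + (n+1)
    -- P_n. The identity thus says that (2n+1) Q^{1/2} P_n satisfies the Chebyshev recurrence, as
    -- U_n - U_{n-1} does.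
    have h := halfIntegral_mul_derivative (legendre (n + 2) - legendre n) hx
    have hd := derivative_legendre_sub n
    have c2 : 2 * (n : ℝ[X]) + 3 = C (2 * (n : ℝ) + 3) := by
      simp [map_ofNat C 2, map_ofNat C 3]
    rw [derivative_sub, hd, c2] at h
    have e1 : (fun t => t * eval t (C (2 * (n : ℝ) + 3) * legendre (n + 1)))
        = fun t => ((n : ℝ) + 2) * P (n + 2) t + ((n : ℝ) + 1) * P n t := by
      funext t
      have := P_recurrence n t
      simp only [eval_mul, eval_C]
      unfold P at this ⊢
      linarith
    have e2 : (fun t => eval t (C (2 * (n : ℝ) + 3) * legendre (n + 1)))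
        = fun t => (2 * (n : ℝ) + 3) * P (n + 1) t := by
      funext t; simp [P]
    have e3 : (fun t => eval t (legendre (n + 2) - legendre n)
        - eval (-1) (legendre (n + 2) - legendre n)) = fun t => P (n + 2) t - P n t := by
      funext t
      have h1 := P_at_neg_one (n + 2)
      have h2 := P_at_neg_one n
      simp only [P] at h1 h2
      simp only [eval_sub, h1, h2, P, pow_add]
      ring
    have hc := continuous_P
    rw [e1, e2, e3, halfIntegral_add (by fun_prop) (by fun_prop) hx,
      halfIntegral_sub (by fun_prop) (by fun_prop) hx] at h
    simp only [halfIntegral_const_mul] at h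
    have hU : ∀ m : ℤ, eval x (Chebyshev.U ℝ (m + 2))
        = 2 * x * eval x (Chebyshev.U ℝ (m + 1)) - eval x (Chebyshev.U ℝ m) := fun m => by
      simp [Chebyshev.U_add_two]
    have u2 := hU n
    have u1 := hU ((n : ℤ) - 1)
    simp only [U] at ih0 ih1 ⊢
    push_cast at ih0 ih1 ⊢
    rw [show (n : ℤ) - 1 + 2 = n + 1 by ring, show (n : ℤ) - 1 + 1 = n by ring] at u1
    rw [show (n : ℤ) + 1 - 1 = n by ring] at ih1
    rw [show (n : ℤ) + 2 - 1 = n + 1 by ring]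
    rw [u2, u1]
    rw [u1] at ih1
    linear_combination 2 * h + 2 * x * ih1 - ih0

/-- Up to constants, √(1+t)(U_{n+1} - U_n) is the half-integral of P_{n+1}, so its own half-integral
is the ordinary integral, a multiple of P_{n+2} - P_n. Summing over n telescopes to the claim. -/
theorem halfIntegral_sqrt_mul_U (n : ℕ) {x : ℝ} (hx : -1 ≤ x) :
    halfIntegral (fun t => √(1 + t) * U n t) x = √Real.pi / 2 * (P n x + P (n + 1) x) := by
  have hp0 : √Real.pi ≠ 0 := (Real.sqrt_pos.2 Real.pi_pos).ne'
  have hc := continuous_U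
  induction n with
  | zero =>
    have h := halfIntegral_halfIntegral_derivative X
      (g := fun t => 2 / √Real.pi * (√(1 + t) * U 0 t)) (fun t ht => by
        have := mul_halfIntegral_P 0 ht
        simp [U] at this
        simp [U, ← this]
        congr 1
        funext t
        simp [P_zero]) hx
    rw [halfIntegral_const_mul] at h
    simp only [eval_X, sub_neg_eq_add] at h
    rw [P_zero, P_one]
    field_simp at h ⊢
    linarith
  | succ n ih =>
    have h := halfIntegral_halfIntegral_derivative (legendre (n + 2) - legendre n)
      (g := fun t => 2 / √Real.pi * (√(1 + t) * U (n + 1) t - √(1 + t) * U n t)) (fun t ht => by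
        have := mul_halfIntegral_P (n + 1) ht
        push_cast at this
        rw [derivative_sub, derivative_legendre_sub n]
        have e : (fun t => eval t ((2 * (n : ℝ[X]) + 3) * legendre (n + 1)))
            = fun t => (2 * ((n : ℝ) + 1) + 1) * P (n + 1) t := by
          funext t; simp [P]; left; ring
        rw [e, halfIntegral_const_mul, this, show (n : ℤ) + 1 - 1 = n by ring]
        simp only [U]
        push_cast
        ring) hx
    rw [halfIntegral_const_mul, halfIntegral_sub (by fun_prop) (by fun_prop) hx, ih] at h
    have h1 := P_at_neg_one (n + 2)
    have h2 := P_at_neg_one n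
    simp only [P] at h1 h2
    simp only [eval_sub, h1, h2, pow_add] at h
    have e1 : eval x (legendre (n + 2)) = P (n + 2) x := rfl
    have e2 : eval x (legendre n) = P n x := rfl
    rw [e1, e2] at h
    field_simp at h ⊢
    linarith

/-- Two half-integrations of a Legendre polynomial. -/
theorem halfIntegral_halfIntegral_P (n : ℕ) {x : ℝ} (hx : -1 ≤ x) :
    halfIntegral (halfIntegral (P (n + 1))) x
      = 1 / (2 * (n : ℝ) + 3) * (P (n + 2) x - P n x) := by
  have h := halfIntegral_halfIntegral_derivative
    (C (1 / (2 * (n : ℝ) + 3)) * (legendre (n + 2) - legendre n)) (g := halfIntegral (P (n + 1)))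
    (fun t _ => by
      congr 1
      funext s
      rw [derivative_C_mul, derivative_sub, derivative_legendre_sub n]
      have : (2 * (n : ℝ) + 3) ≠ 0 := by positivity
      simp [P]
      field_simp) hx
  have h1 := P_at_neg_one (n + 2)
  have h2 := P_at_neg_one n
  simp only [P] at h1 h2
  rw [h]
  simp only [eval_mul, eval_C, eval_sub, h1, h2, pow_add, P]
  ring

end Polynomial

/-! ### The basis functions in `L²[-1,1]` -/

section Basis

variable {𝕜 : Type*} [RCLike 𝕜]

theorem memLp_of_continuous {g : ℝ → 𝕜} (hg : Continuous g) : MemLp g 2 vol := by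
  obtain ⟨C, hC⟩ := (isCompact_Icc (a := (-1 : ℝ)) (b := 1)).exists_bound_of_continuousOn
    hg.continuousOn
  refine MemLp.of_bound hg.aestronglyMeasurable C ?_
  filter_upwards [ae_restrict_mem measurableSet_Icc] with x hx using hC x hx

theorem continuous_ofReal_P (n : ℕ) : Continuous fun x => ((P n x : ℝ) : 𝕜) :=
  RCLike.continuous_ofReal.comp (continuous_P n)

theorem continuous_ofReal_sqrt_mul_U (n : ℕ) :
    Continuous fun x => ((√(1 + x) * U n x : ℝ) : 𝕜) := by
  have := continuous_U n
  exact RCLike.continuous_ofReal.comp (by fun_prop)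

variable (𝕜) in
/-- `P_n` as an element of `L²[-1,1]`. -/
noncomputable def legendreL2 (n : ℕ) : L2 𝕜 :=
  (memLp_of_continuous (continuous_ofReal_P n)).toLp _

variable (𝕜) in
/-- `√(1+x) U_n` as an element of `L²[-1,1]`. -/
noncomputable def chebyshevL2 (n : ℕ) : L2 𝕜 :=
  (memLp_of_continuous (continuous_ofReal_sqrt_mul_U n)).toLp _

theorem coeFn_legendreL2 (n : ℕ) : legendreL2 𝕜 n =ᵐ[vol] fun x => ((P n x : ℝ) : 𝕜) :=
  MemLp.coeFn_toLp _

theorem coeFn_chebyshevL2 (n : ℕ) :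
    chebyshevL2 𝕜 n =ᵐ[vol] fun x => ((√(1 + x) * U n x : ℝ) : 𝕜) :=
  MemLp.coeFn_toLp _

theorem norm_legendreL2_sq (n : ℕ) : ‖legendreL2 𝕜 n‖ ^ 2 = 2 / (2 * (n : ℝ) + 1) := by
  have h : RCLike.re (inner 𝕜 (legendreL2 𝕜 n) (legendreL2 𝕜 n)) = ‖legendreL2 𝕜 n‖ ^ 2 :=
    inner_self_eq_norm_sq _
  have h2 : inner 𝕜 (legendreL2 𝕜 n) (legendreL2 𝕜 n)
      = ∫ x, ((P n x ^ 2 : ℝ) : 𝕜) ∂vol := by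
    rw [L2.inner_def]
    refine integral_congr_ae ?_
    filter_upwards [coeFn_legendreL2 (𝕜 := 𝕜) n] with x hx
    rw [hx, RCLike.inner_apply, RCLike.conj_ofReal, sq, RCLike.ofReal_mul]
  rw [← h, h2, integral_ofReal, RCLike.ofReal_re, integral_Icc_eq_integral_Ioc,
    ← intervalIntegral.integral_of_le (by norm_num), integral_P_sq]

theorem norm_legendreL2 (n : ℕ) : ‖legendreL2 𝕜 n‖ = √(2 / (2 * (n : ℝ) + 1)) := by
  rw [← norm_legendreL2_sq (𝕜 := 𝕜), Real.sqrt_sq (norm_nonneg _)]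

theorem tendsto_norm_legendreL2 : Tendsto (fun n => ‖legendreL2 𝕜 n‖) atTop (𝓝 0) := by
  simp only [norm_legendreL2]
  have h1 : Tendsto (fun n : ℕ => 2 * (n : ℝ) + 1) atTop atTop :=
    tendsto_atTop_add_const_right _ _
      (tendsto_natCast_atTop_atTop.const_mul_atTop (by norm_num))
  have h2 := (Real.continuous_sqrt.tendsto 0).comp (h1.const_div_atTop 2)
  rw [Real.sqrt_zero] at h2
  exact h2

theorem norm_legendreL2_le_of_le {m n : ℕ} (h : m ≤ n) :
    ‖legendreL2 𝕜 n‖ ≤ ‖legendreL2 𝕜 m‖ := by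
  have : (m : ℝ) ≤ n := Nat.cast_le.2 h
  rw [norm_legendreL2, norm_legendreL2]
  gcongr

theorem halfIntegralL2_eq_of_ae {v w : L2 𝕜} {g h : ℝ → ℝ} (hv : v =ᵐ[vol] fun x => ((g x : ℝ) : 𝕜))
    (hw : w =ᵐ[vol] fun x => ((h x : ℝ) : 𝕜)) (hgh : ∀ x, -1 ≤ x → halfIntegral g x = h x) :
    halfIntegralL2 𝕜 v = w := by
  refine Lp.ext ?_
  filter_upwards [halfIntegralL2_ae v, hw, ae_restrict_mem measurableSet_Icc] with x h1 h2 hx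
  rw [h1, h2, halfIntegral_congr hv hx, halfIntegral_ofReal, hgh x hx.1]

theorem coeFn_sum_smul {ι : Type*} (s : Finset ι) (c : ι → 𝕜) {v : ι → L2 𝕜} {g : ι → ℝ → 𝕜}
    (hv : ∀ i, v i =ᵐ[vol] g i) :
    (∑ i ∈ s, c i • v i : L2 𝕜) =ᵐ[vol] fun x => ∑ i ∈ s, c i * g i x := by
  classical
  induction s using Finset.induction_on with
  | empty =>
    simp only [Finset.sum_empty]
    exact Lp.coeFn_zero _ _ _
  | insert i s hi ih =>
    rw [Finset.sum_insert hi]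
    filter_upwards [Lp.coeFn_add (c i • v i) (∑ i ∈ s, c i • v i), Lp.coeFn_smul (c i) (v i),
      hv i, ih] with x h1 h2 h3 h4
    rw [h1, Pi.add_apply, h2, Pi.smul_apply, h3, h4, Finset.sum_insert hi, smul_eq_mul]

/-- Column n of `QP` lives in rows n-1 and n, so nothing leaves the first N basis elements. -/
theorem halfIntegralL2_legendreL2 {n N : ℕ} (hn : n < N) :
    halfIntegralL2 𝕜 (legendreL2 𝕜 n)
      = ∑ k ∈ Finset.range N, ((QP k n : ℝ) : 𝕜) • chebyshevL2 𝕜 k := by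
  refine halfIntegralL2_eq_of_ae (h := fun x => ∑ k ∈ Finset.range N, QP k n * (√(1 + x) * U k x))
    (coeFn_legendreL2 n) ?_ fun x hx => ?_
  · refine (coeFn_sum_smul _ _ fun k => coeFn_chebyshevL2 k).trans (Eventually.of_forall fun x => ?_)
    push_cast
    rfl
  · have h := mul_halfIntegral_P n hx
    have hn0 : (2 * (n : ℝ) + 1) ≠ 0 := by positivity
    refine mul_left_cancel₀ hn0 (h.trans ?_)
    rcases n with _ | n
    · rw [Finset.sum_eq_single 0]
      · simp [QP, U]
      · intro k _ hk; simp [QP, hk]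
      · intro h0; exact absurd (Finset.mem_range.2 hn) h0
    · have e : ∀ k, QP k (n + 1) * (√(1 + x) * U k x)
          = 2 / √Real.pi * (1 / (2 * ((n + 1 : ℕ) : ℝ) + 1)) * ((if k = n + 1 then √(1 + x) * U k x else 0)
            - (if k = n then √(1 + x) * U k x else 0)) := fun k => by
        unfold QP
        by_cases h1 : k = n + 1
        · simp [h1]
        · by_cases h2 : k = n
          · simp [h2]
          · simp [h1, h2]
      simp only [e]
      rw [← Finset.mul_sum, Finset.sum_sub_distrib, Finset.sum_ite_eq', Finset.sum_ite_eq',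
        if_pos (Finset.mem_range.2 hn), if_pos (Finset.mem_range.2 (by omega))]
      have : ((n + 1 : ℕ) : ℤ) - 1 = n := by push_cast; ring
      rw [this]
      field_simp
      rfl

/-- Column n of `QU` reaches row n+1, hence the range N+1; the row N is the only leak of the
truncation. -/
theorem halfIntegralL2_chebyshevL2 {n N : ℕ} (hn : n < N) :
    halfIntegralL2 𝕜 (chebyshevL2 𝕜 n)
      = ∑ k ∈ Finset.range (N + 1), ((QU k n : ℝ) : 𝕜) • legendreL2 𝕜 k := by
  refine halfIntegralL2_eq_of_ae (h := fun x => ∑ k ∈ Finset.range (N + 1), QU k n * P k x)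
    (coeFn_chebyshevL2 n) ?_ fun x hx => ?_
  · refine (coeFn_sum_smul _ _ fun k => coeFn_legendreL2 k).trans (Eventually.of_forall fun x => ?_)
    push_cast
    rfl
  · rw [halfIntegral_sqrt_mul_U n hx]
    have e : ∀ k, QU k n * P k x = √Real.pi / 2 * ((if k = n then P k x else 0)
            + (if k = n + 1 then P k x else 0)) := fun k => by
      unfold QU
      by_cases h1 : k = n
      · simp [h1]
      · by_cases h2 : k = n + 1
        · simp [h2]
        · simp [h1, h2]
    simp only [e]
    rw [← Finset.mul_sum, Finset.sum_add_distrib, Finset.sum_ite_eq', Finset.sum_ite_eq',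
      if_pos (Finset.mem_range.2 (by omega)), if_pos (Finset.mem_range.2 (by omega))]

theorem halfIntegralL2_halfIntegralL2_legendreL2 (n : ℕ) :
    halfIntegralL2 𝕜 (halfIntegralL2 𝕜 (legendreL2 𝕜 (n + 1)))
      = ((1 / (2 * (n : ℝ) + 3) : ℝ) : 𝕜) • (legendreL2 𝕜 (n + 2) - legendreL2 𝕜 n) := by
  refine halfIntegralL2_eq_of_ae (g := halfIntegral (P (n + 1)))
    (h := fun x => 1 / (2 * (n : ℝ) + 3) * (P (n + 2) x - P n x)) ?_ ?_
    fun x hx => halfIntegral_halfIntegral_P n hx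
  · filter_upwards [halfIntegralL2_ae (legendreL2 𝕜 (n + 1)),
      ae_restrict_mem measurableSet_Icc] with x h1 hx
    rw [h1, halfIntegral_congr (coeFn_legendreL2 (n + 1)) hx, halfIntegral_ofReal]
  · filter_upwards [Lp.coeFn_smul (((1 / (2 * (n : ℝ) + 3) : ℝ) : 𝕜))
        (legendreL2 𝕜 (n + 2) - legendreL2 𝕜 n),
      Lp.coeFn_sub (legendreL2 𝕜 (n + 2)) (legendreL2 𝕜 n), coeFn_legendreL2 (𝕜 := 𝕜) (n + 2),
      coeFn_legendreL2 (𝕜 := 𝕜) n] with x h1 h2 h3 h4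
    rw [h1, Pi.smul_apply, h2, Pi.sub_apply, h3, h4]
    simp

/-- The half-integral is not invertible on `L²[-1,1]`. -/
theorem not_isUnit_halfIntegralL2 : ¬ IsUnit (halfIntegralL2 𝕜) := by
  rintro ⟨A, hA⟩
  set K : L2 𝕜 →L[𝕜] L2 𝕜 := ((A⁻¹ : (L2 𝕜 →L[𝕜] L2 𝕜)ˣ) : L2 𝕜 →L[𝕜] L2 𝕜) with hK
  have hinv : ∀ v, K (halfIntegralL2 𝕜 v) = v := fun v => by
    have h : K * halfIntegralL2 𝕜 = 1 := by rw [← hA, hK]; exact Units.inv_mul A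
    exact congrArg (fun T : L2 𝕜 →L[𝕜] L2 𝕜 => T v) h
  have hb : ∀ v, ‖v‖ ≤ ‖K‖ * ‖halfIntegralL2 𝕜 v‖ := fun v => by
    conv_lhs => rw [← hinv v]
    exact K.le_opNorm _
  -- Apply the inverse bound twice to P_{n+1}. The 3 comes from ‖P_{n+2}‖ ≤ ‖P_{n+1}‖ and ‖P_n‖ ≤
  -- 2‖P_{n+1}‖.
  have key : ∀ n : ℕ, (2 * (n : ℝ) + 3) ≤ 3 * ‖K‖ ^ 2 := fun n => by
    have h1 : ‖legendreL2 𝕜 (n + 1)‖ ≤ ‖K‖ * (‖K‖ * (1 / (2 * (n : ℝ) + 3)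
        * (‖legendreL2 𝕜 (n + 2)‖ + ‖legendreL2 𝕜 n‖))) := by
      refine (hb _).trans (mul_le_mul_of_nonneg_left ((hb _).trans ?_) (norm_nonneg _))
      rw [halfIntegralL2_halfIntegralL2_legendreL2, norm_smul,
        RCLike.norm_of_nonneg (by positivity)]
      gcongr
      exact norm_sub_le _ _
    have h2 : ‖legendreL2 𝕜 (n + 2)‖ ≤ ‖legendreL2 𝕜 (n + 1)‖ :=
      norm_legendreL2_le_of_le (by omega)
    have h3 : ‖legendreL2 𝕜 n‖ ≤ 2 * ‖legendreL2 𝕜 (n + 1)‖ := by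
      refine abs_le_of_sq_le_sq' ?_ (by positivity) |>.2
      rw [mul_pow, norm_legendreL2_sq, norm_legendreL2_sq]
      push_cast
      rw [mul_div_assoc', div_le_div_iff₀ (by positivity) (by positivity)]
      linarith [Nat.cast_nonneg (α := ℝ) n]
    have hpos : 0 < ‖legendreL2 𝕜 (n + 1)‖ := by
      rw [norm_legendreL2]; positivity
    have hn : 0 < 2 * (n : ℝ) + 3 := by positivity
    have h4 : ‖legendreL2 𝕜 (n + 1)‖ * (2 * (n : ℝ) + 3)
        ≤ ‖legendreL2 𝕜 (n + 1)‖ * (3 * ‖K‖ ^ 2) := by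
      have h5 : ‖legendreL2 𝕜 (n + 1)‖ ≤ ‖K‖ * (‖K‖ * (1 / (2 * (n : ℝ) + 3)
          * (3 * ‖legendreL2 𝕜 (n + 1)‖))) := by
        refine h1.trans ?_
        gcongr
        linarith
      calc ‖legendreL2 𝕜 (n + 1)‖ * (2 * (n : ℝ) + 3)
          ≤ ‖K‖ * (‖K‖ * (1 / (2 * (n : ℝ) + 3)
            * (3 * ‖legendreL2 𝕜 (n + 1)‖))) * (2 * (n : ℝ) + 3) := by gcongr
        _ = ‖legendreL2 𝕜 (n + 1)‖ * (3 * ‖K‖ ^ 2) := by field_simp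
    exact le_of_mul_le_mul_left h4 hpos
  obtain ⟨n, hn⟩ := exists_nat_gt (3 * ‖K‖ ^ 2)
  have := key n
  linarith [Nat.cast_nonneg (α := ℝ) n]

end Basis

/-! ### Bounded solutions of the homogeneous recurrence -/

section Recurrence

variable {𝕜 : Type*} [RCLike 𝕜]

theorem summable_smul_of_abs_le_one {r : ℕ → ℝ} {a : ℕ → 𝕜} (ha : Summable fun n => ‖a n‖)
    (hr : ∀ n, |r n| ≤ 1) : Summable fun n => r n • a n :=
  Summable.of_norm_bounded ha fun n => by
    rw [norm_smul, Real.norm_eq_abs]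
    exact mul_le_of_le_one_left (norm_nonneg _) (hr n)

theorem integral_cos_int_mul (k : ℤ) :
    ∫ θ in (0 : ℝ)..Real.pi, Real.cos (k * θ) = if k = 0 then Real.pi else 0 := by
  split_ifs with h
  · simp [h]
  · have hk : (k : ℝ) ≠ 0 := Int.cast_ne_zero.2 h
    rw [intervalIntegral.integral_comp_mul_left _ hk, integral_cos, Real.sin_int_mul_pi]
    simp

theorem integral_sin_mul_sin (n m : ℕ) (hm : m ≠ 0) :
    ∫ θ in (0 : ℝ)..Real.pi, Real.sin (m * θ) * Real.sin (n * θ)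
      = if n = m then Real.pi / 2 else 0 := by
  have e : ∀ θ : ℝ, Real.sin (m * θ) * Real.sin (n * θ)
      = 1 / 2 * (Real.cos (((m - n : ℤ) : ℝ) * θ) - Real.cos (((m + n : ℤ) : ℝ) * θ)) := fun θ => by
    push_cast
    rw [sub_mul, add_mul, Real.cos_sub, Real.cos_add]
    ring
  simp only [e]
  rw [intervalIntegral.integral_const_mul, intervalIntegral.integral_sub
    (Continuous.intervalIntegrable (by fun_prop) _ _)
    (Continuous.intervalIntegrable (by fun_prop) _ _), integral_cos_int_mul, integral_cos_int_mul,
    if_neg (show (m : ℤ) + n ≠ 0 by omega)]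
  by_cases h : n = m
  · rw [if_pos h, if_pos (by omega)]; ring
  · rw [if_neg h, if_neg (by omega)]; ring

/-- Orthogonality of sines on [0,π], with termwise integration dominated by Σ‖B_n‖. The series does
not see B 0. -/
theorem eq_zero_of_tsum_sin_eq_zero {B : ℕ → 𝕜} (hB0 : B 0 = 0) (hB : Summable fun n => ‖B n‖)
    (h : ∀ θ : ℝ, ∑' n : ℕ, Real.sin (n * θ) • B n = 0) (m : ℕ) : B m = 0 := by
  rcases Nat.eq_zero_or_pos m with rfl | hm
  · exact hB0
  have hsum := intervalIntegral.hasSum_integral_of_dominated_convergence (a := 0) (b := Real.pi)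
    (μ := volume) (F := fun (n : ℕ) (θ : ℝ) => (Real.sin (m * θ) * Real.sin (n * θ)) • B n)
    (f := fun _ => 0) (fun n _ => ‖B n‖)
    (fun n => (Continuous.aestronglyMeasurable (by fun_prop)))
    (fun n => Eventually.of_forall fun θ _ => by
      rw [norm_smul, Real.norm_eq_abs, abs_mul]
      exact mul_le_of_le_one_left (norm_nonneg _) (mul_le_one₀ (Real.abs_sin_le_one _)
        (abs_nonneg _) (Real.abs_sin_le_one _)))
    (Eventually.of_forall fun _ _ => hB) intervalIntegrable_const
    (Eventually.of_forall fun θ _ => by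
      have hs := (summable_smul_of_abs_le_one hB
        (fun n => Real.abs_sin_le_one (n * θ))).hasSum
      rw [h θ] at hs
      simpa [mul_smul] using hs.const_smul (Real.sin (m * θ)))
  simp only [intervalIntegral.integral_zero, intervalIntegral.integral_smul_const,
    integral_sin_mul_sin _ m hm.ne'] at hsum
  have h2 := hasSum_single (f := fun n : ℕ => (if n = m then Real.pi / 2 else 0 : ℝ) • B n) m
    (fun n hn => by simp [hn])
  have h3 := hsum.unique h2
  simp only [if_true] at h3
  exact (smul_eq_zero.1 h3.symm).resolve_left (by positivity)

/-- The quotient `(B_{k+1} + B_k) / (2k+1)`. -/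
noncomputable def scaledSum (B : ℕ → 𝕜) (k : ℕ) : 𝕜 :=
  (1 / (2 * (k : ℝ) + 1)) • (B (k + 1) + B k)

theorem norm_scaledSum (B : ℕ → 𝕜) (k : ℕ) :
    ‖scaledSum B k‖ = 1 / (2 * (k : ℝ) + 1) * ‖B (k + 1) + B k‖ := by
  rw [scaledSum, norm_smul, Real.norm_of_nonneg (by positivity)]

/-- The denominator 2k+1 in `scaledSum` gains one power of k each time the recurrence is used. -/
theorem exists_decay_of_recurrence {c : 𝕜} (hc : c ≠ 0) {B : ℕ → 𝕜} (hB0 : B 0 = 0)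
    (hrec : ∀ k, c * B (k + 1) = scaledSum B k - scaledSum B (k + 1)) (j : ℕ) {M : ℝ}
    (hM : ∀ k, ‖B k‖ ≤ M / ((k : ℝ) + 1) ^ j) :
    ∃ M' : ℝ, ∀ k, ‖B k‖ ≤ M' / ((k : ℝ) + 1) ^ (j + 1) := by
  have hM0 : 0 ≤ M := by simpa using (norm_nonneg _).trans (hM 0)
  have hc' : 0 < ‖c‖ := norm_pos_iff.2 hc
  -- Two `scaledSum` terms contribute 4M, and passing from k+1 to k+2 ≤ 2(k+1) in the denominator
  -- costs 2^{j+1}.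
  refine ⟨8 * 2 ^ j * M / ‖c‖, fun k => ?_⟩
  rcases k with _ | k
  · rw [hB0, norm_zero]; positivity
  have hb : ∀ l, k ≤ l → ‖B l‖ ≤ M / ((k : ℝ) + 1) ^ j := fun l hl =>
    (hM l).trans (by gcongr)
  have hs : ∀ l, k ≤ l → ‖scaledSum B l‖ ≤ 2 * M / ((k : ℝ) + 1) ^ (j + 1) := fun l hl => by
    have hkl : (k : ℝ) ≤ l := Nat.cast_le.2 hl
    calc ‖scaledSum B l‖ = 1 / (2 * (l : ℝ) + 1) * ‖B (l + 1) + B l‖ := norm_scaledSum B l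
      _ ≤ 1 / ((k : ℝ) + 1) * (M / ((k : ℝ) + 1) ^ j + M / ((k : ℝ) + 1) ^ j) := by
          refine mul_le_mul ?_ ?_ (norm_nonneg _) (by positivity)
          · exact one_div_le_one_div_of_le (by positivity) (by linarith [Nat.cast_nonneg (α := ℝ) k])
          · exact (norm_add_le _ _).trans (add_le_add (hb _ (by omega)) (hb _ hl))
      _ = 2 * M / ((k : ℝ) + 1) ^ (j + 1) := by field_simp; ring
  have h1 : ‖c‖ * ‖B (k + 1)‖ ≤ 4 * M / ((k : ℝ) + 1) ^ (j + 1) := by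
    rw [← norm_mul, hrec]
    refine (norm_sub_le _ _).trans ((add_le_add (hs k le_rfl) (hs (k + 1) (by omega))).trans ?_)
    apply le_of_eq; ring
  have h2 : 4 * M / ((k : ℝ) + 1) ^ (j + 1) ≤ 8 * 2 ^ j * M / (((k + 1 : ℕ) : ℝ) + 1) ^ (j + 1) := by
    rw [div_le_div_iff₀ (by positivity) (by positivity)]
    have h3 : (((k + 1 : ℕ) : ℝ) + 1) ^ (j + 1) ≤ (2 * ((k : ℝ) + 1)) ^ (j + 1) := by
      refine pow_le_pow_left₀ (by positivity) ?_ _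
      push_cast
      linarith [Nat.cast_nonneg (α := ℝ) k]
    calc 4 * M * (((k + 1 : ℕ) : ℝ) + 1) ^ (j + 1)
        ≤ 4 * M * (2 * ((k : ℝ) + 1)) ^ (j + 1) := by gcongr
      _ = 8 * 2 ^ j * M * ((k : ℝ) + 1) ^ (j + 1) := by rw [mul_pow, pow_succ 2]; ring
  rw [div_right_comm, le_div_iff₀ hc', mul_comm]
  exact h1.trans h2

theorem summable_norm_of_recurrence {c : 𝕜} (hc : c ≠ 0) {B : ℕ → 𝕜} (hB0 : B 0 = 0)
    (hrec : ∀ k, c * B (k + 1) = scaledSum B k - scaledSum B (k + 1)) {M : ℝ}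
    (hM : ∀ k, ‖B k‖ ≤ M) : Summable fun k => ‖B k‖ := by
  obtain ⟨M₁, h₁⟩ := exists_decay_of_recurrence hc hB0 hrec 0 (M := M) (by simpa using hM)
  obtain ⟨M₂, h₂⟩ := exists_decay_of_recurrence hc hB0 hrec 1 h₁
  have hs : Summable fun k : ℕ => M₂ * (1 / ((k : ℝ) + 1) ^ 2) := by
    have := (summable_nat_add_iff 1).2 (Real.summable_one_div_nat_pow.2 (show 1 < 2 by norm_num))
    push_cast at this
    exact this.mul_left M₂
  exact Summable.of_nonneg_of_le (fun _ => norm_nonneg _)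
    (fun k => (h₂ k).trans (le_of_eq (by ring))) hs

/-- The sine series with coefficients `B`. -/
noncomputable def sineSeries (B : ℕ → 𝕜) (θ : ℝ) : 𝕜 := ∑' n : ℕ, Real.sin (n * θ) • B n

/-- The series of `cos ((n + 1/2) θ)` with coefficients `scaledSum B`. -/
noncomputable def cosineSeries (B : ℕ → 𝕜) (θ : ℝ) : 𝕜 :=
  ∑' n : ℕ, Real.cos (((n : ℝ) + 1 / 2) * θ) • scaledSum B n

theorem summable_norm_add_succ {B : ℕ → 𝕜} (hB : Summable fun n => ‖B n‖) :
    Summable fun k => ‖B (k + 1) + B k‖ :=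
  Summable.of_nonneg_of_le (fun _ => norm_nonneg _) (fun _ => norm_add_le _ _)
    (((summable_nat_add_iff 1).2 hB).add hB)

theorem summable_norm_scaledSum {B : ℕ → 𝕜} (hB : Summable fun n => ‖B n‖) :
    Summable fun k => ‖scaledSum B k‖ := by
  refine Summable.of_nonneg_of_le (fun _ => norm_nonneg _) (fun k => ?_)
    (summable_norm_add_succ hB)
  rw [norm_scaledSum]
  refine mul_le_of_le_one_left (norm_nonneg _) ?_
  rw [div_le_one (by positivity)]
  linarith [Nat.cast_nonneg (α := ℝ) k]

/-- Summation by parts, with sin((n+1)θ) - sin(nθ) = 2 sin(θ/2) cos((n+1/2)θ). -/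
theorem mul_sineSeries {c : 𝕜} {B : ℕ → 𝕜} (hB0 : B 0 = 0) (hB : Summable fun n => ‖B n‖)
    (hrec : ∀ k, c * B (k + 1) = scaledSum B k - scaledSum B (k + 1)) (θ : ℝ) :
    c * sineSeries B θ = (2 * Real.sin (θ / 2)) • cosineSeries B θ := by
  have hd := summable_norm_scaledSum hB
  have hd1 : Summable fun k => ‖scaledSum B (k + 1)‖ := (summable_nat_add_iff 1).2 hd
  have hs : ∀ {a : ℕ → 𝕜} (m : ℕ), Summable (fun n => ‖a n‖) →
      Summable fun n : ℕ => Real.sin (((n + m : ℕ) : ℝ) * θ) • a n := fun m ha =>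
    summable_smul_of_abs_le_one ha fun n => Real.abs_sin_le_one _
  have h0 : c * sineSeries B θ = ∑' n : ℕ, c * Real.sin (n * θ) • B n := tsum_mul_left.symm
  have h1 : ∑' n : ℕ, c * Real.sin (n * θ) • B n
      = ∑' n : ℕ, c * Real.sin (((n + 1 : ℕ) : ℝ) * θ) • B (n + 1) := by
    have h := ((hs 0 hB).mul_left c).tsum_eq_zero_add
    simp only [add_zero, hB0, smul_zero, mul_zero, zero_add] at h
    exact h
  have h2 : ∀ n : ℕ, c * Real.sin (((n + 1 : ℕ) : ℝ) * θ) • B (n + 1)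
      = Real.sin (((n + 1 : ℕ) : ℝ) * θ) • scaledSum B n
        - Real.sin (((n + 1 : ℕ) : ℝ) * θ) • scaledSum B (n + 1) := fun n => by
    rw [mul_smul_comm, hrec, smul_sub]
  have h3 : ∑' n : ℕ, Real.sin (((n + 1 : ℕ) : ℝ) * θ) • scaledSum B (n + 1)
      = ∑' n : ℕ, Real.sin (n * θ) • scaledSum B n := by
    have h := (hs 0 hd).tsum_eq_zero_add
    simp only [add_zero, Nat.cast_zero, zero_mul, Real.sin_zero, zero_smul, zero_add] at h
    exact h.symm
  have h4 : ∀ n : ℕ, Real.sin (((n + 1 : ℕ) : ℝ) * θ) • scaledSum B n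
      - Real.sin (n * θ) • scaledSum B n
      = (2 * Real.sin (θ / 2)) • Real.cos (((n : ℝ) + 1 / 2) * θ) • scaledSum B n := fun n => by
    rw [← sub_smul, smul_smul, Real.sin_sub_sin,
      show (((n + 1 : ℕ) : ℝ) * θ - n * θ) / 2 = θ / 2 by push_cast; ring,
      show (((n + 1 : ℕ) : ℝ) * θ + n * θ) / 2 = ((n : ℝ) + 1 / 2) * θ by push_cast; ring]
  have hs0 : Summable fun n : ℕ => Real.sin (n * θ) • scaledSum B n := hs 0 hd
  rw [h0, h1, tsum_congr h2, (hs 1 hd).tsum_sub (hs 1 hd1), h3,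
    ← (hs 1 hd).tsum_sub hs0, tsum_congr h4]
  exact tsum_const_smul'' _

/-- The factor n+1/2 from differentiation cancels the denominator 2n+1, so the derived series
converges absolutely. After an index shift, sin((n-1/2)θ) + sin((n+1/2)θ) = 2 cos(θ/2) sin(nθ). -/
theorem hasDerivAt_cosineSeries {B : ℕ → 𝕜} (hB0 : B 0 = 0) (hB : Summable fun n => ‖B n‖)
    (θ : ℝ) : HasDerivAt (cosineSeries B) (-(Real.cos (θ / 2) • sineSeries B θ)) θ := by
  have hd := summable_norm_scaledSum hB
  have hB1 : Summable fun k => ‖B (k + 1)‖ := (summable_nat_add_iff 1).2 hB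
  have hBB := summable_norm_add_succ hB
  have h := hasDerivAt_tsum (𝕜 := ℝ) (u := fun n => ‖B (n + 1) + B n‖)
    (g := fun (n : ℕ) (θ : ℝ) => Real.cos (((n : ℝ) + 1 / 2) * θ) • scaledSum B n)
    (g' := fun (n : ℕ) (θ : ℝ) =>
      (-(1 / 2) * Real.sin (((n : ℝ) + 1 / 2) * θ)) • (B (n + 1) + B n))
    (y₀ := 0) hBB (fun n y => by
      have h1 : HasDerivAt (fun y : ℝ => Real.cos (((n : ℝ) + 1 / 2) * y))
          (-Real.sin (((n : ℝ) + 1 / 2) * y) * (((n : ℝ) + 1 / 2) * 1)) y :=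
        ((hasDerivAt_id y).const_mul ((n : ℝ) + 1 / 2)).cos
      have h2 := h1.smul_const (scaledSum B n)
      refine h2.congr_deriv ?_
      rw [scaledSum, smul_smul]
      congr 1
      have : (2 * (n : ℝ) + 1) ≠ 0 := by positivity
      field_simp) (fun n y => by
      rw [norm_smul, Real.norm_eq_abs, abs_mul]
      refine mul_le_of_le_one_left (norm_nonneg _) ?_
      have := Real.abs_sin_le_one (((n : ℝ) + 1 / 2) * y)
      norm_num
      linarith) (by simpa using hd.of_norm) θ
  refine h.congr_deriv ?_
  have hS : ∀ a : ℝ, Summable fun n : ℕ => Real.sin (((n : ℝ) + a) * θ) • B n := fun a =>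
    summable_smul_of_abs_le_one hB fun n => Real.abs_sin_le_one _
  have hS1 : Summable fun n : ℕ => Real.sin (((n : ℝ) + 1 / 2) * θ) • B (n + 1) :=
    summable_smul_of_abs_le_one hB1 fun n => Real.abs_sin_le_one _
  have e1 : ∑' n : ℕ, Real.sin (((n : ℝ) + 1 / 2) * θ) • B (n + 1)
      = ∑' n : ℕ, Real.sin (((n : ℝ) + -(1 / 2)) * θ) • B n := by
    rw [(hS (-(1 / 2))).tsum_eq_zero_add, hB0, smul_zero, zero_add]
    refine tsum_congr fun n => ?_
    congr 3
    push_cast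
    ring
  simp only [mul_smul]
  rw [tsum_const_smul'']
  simp only [smul_add]
  rw [Summable.tsum_add hS1 (hS (1 / 2)), e1, ← Summable.tsum_add (hS _) (hS _), sineSeries,
    ← tsum_const_smul'', ← tsum_const_smul'', ← tsum_neg]
  refine tsum_congr fun n => ?_
  rw [← add_smul, smul_smul, smul_smul, ← neg_smul]
  congr 1
  rw [add_mul, add_mul, Real.sin_add, Real.sin_add, show 1 / 2 * θ = θ / 2 by ring,
    show -(1 / 2) * θ = -(θ / 2) by ring, Real.sin_neg, Real.cos_neg]
  ring

theorem eq_zero_of_recurrence {c : 𝕜} (hc : c ≠ 0) {B : ℕ → 𝕜} (hB0 : B 0 = 0)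
    (hrec : ∀ k, c * B (k + 1) = scaledSum B k - scaledSum B (k + 1)) {M : ℝ}
    (hM : ∀ k, ‖B k‖ ≤ M) (k : ℕ) : B k = 0 := by
  have hB := summable_norm_of_recurrence hc hB0 hrec hM
  have hGs := mul_sineSeries hB0 hB hrec
  have hode : ∀ θ, HasDerivAt (cosineSeries B) (-(c⁻¹ * (Real.sin θ • cosineSeries B θ))) θ := fun θ => by
    refine (hasDerivAt_cosineSeries hB0 hB θ).congr_deriv ?_
    have h : sineSeries B θ = c⁻¹ * ((2 * Real.sin (θ / 2)) • cosineSeries B θ) := by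
      rw [← hGs, inv_mul_cancel_left₀ hc]
    rw [h, ← mul_smul_comm, smul_smul]
    congr 3
    have := Real.sin_two_mul (θ / 2)
    rw [mul_div_cancel₀ _ (two_ne_zero)] at this
    rw [this]
    ring
  -- The initial point is π because every cos((n+1/2)π) vanishes there.
  have hGpi : cosineSeries B Real.pi = 0 := by
    rw [cosineSeries]
    refine (tsum_congr fun n => ?_).trans tsum_zero
    rw [show ((n : ℝ) + 1 / 2) * Real.pi = n * Real.pi + Real.pi / 2 by ring,
      Real.cos_add_pi_div_two, Real.sin_nat_mul_pi, neg_zero, zero_smul]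
  have hGzero : cosineSeries B = fun _ => 0 := by
    refine ODE_solution_unique_univ (v := fun θ y => -(c⁻¹ * (Real.sin θ • y)))
      (s := fun _ => Set.univ) (K := ‖c⁻¹‖₊) (t₀ := Real.pi) (fun θ => ?_)
      (fun θ => ⟨hode θ, trivial⟩) (fun θ => ⟨?_, trivial⟩) hGpi
    · refine (LipschitzWith.of_dist_le_mul fun x y => ?_).lipschitzOnWith
      rw [dist_neg_neg, dist_eq_norm, ← mul_sub, ← smul_sub, norm_mul, norm_smul, dist_eq_norm]
      refine mul_le_mul_of_nonneg_left ?_ (norm_nonneg _)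
      exact mul_le_of_le_one_left (norm_nonneg _) (Real.abs_sin_le_one θ)
    · simpa using hasDerivAt_const θ (0 : 𝕜)
  refine eq_zero_of_tsum_sin_eq_zero hB0 hB (fun θ => ?_) k
  have h := hGs θ
  rw [hGzero, smul_zero] at h
  exact (mul_eq_zero.1 h).resolve_left hc

end Recurrence

/-! ### Stability of the finite sections -/

section Stability

variable {𝕜 : Type*} [RCLike 𝕜]

/-- The residual of the recurrence, truncated to `N` unknowns. -/
noncomputable def truncatedResidual (c : 𝕜) (N : ℕ) (B : ℕ → 𝕜) (k : ℕ) : 𝕜 :=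
  c * B (k + 1) - (scaledSum B k - if k + 1 < N then scaledSum B (k + 1) else 0)

theorem truncatedResidual_smul (c : 𝕜) (N : ℕ) (r : ℝ) (B : ℕ → 𝕜) (k : ℕ) :
    truncatedResidual c N (r • B) k = r • truncatedResidual c N B k := by
  have h : ∀ l, scaledSum (r • B) l = r • scaledSum B l := fun l => by
    simp only [scaledSum, Pi.smul_apply, ← smul_add]
    rw [smul_comm]
  unfold truncatedResidual
  rw [h, h]
  split_ifs
  · simp only [Pi.smul_apply, mul_smul_comm, smul_sub]
  · simp only [Pi.smul_apply, mul_smul_comm, smul_sub, smul_zero]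

theorem norm_scaledSum_le {B : ℕ → 𝕜} {M : ℝ} (hB : ∀ k, ‖B k‖ ≤ M) (k : ℕ) :
    ‖scaledSum B k‖ ≤ 2 * M / ((k : ℝ) + 1) := by
  have hM : 0 ≤ M := (norm_nonneg _).trans (hB 0)
  rw [norm_scaledSum, div_eq_mul_one_div (2 * M), mul_comm (2 * M)]
  refine mul_le_mul ?_ ?_ (norm_nonneg _) (by positivity)
  rotate_left
  · exact (norm_add_le _ _).trans (by linarith [hB k, hB (k + 1)])
  · exact one_div_le_one_div_of_le (by positivity) (by linarith [Nat.cast_nonneg (α := ℝ) k])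

/-- The coupling terms are O(1/k) uniformly in N, so a far entry is governed by its own residual.
This keeps the maximum from escaping to infinity. -/
theorem norm_le_of_truncatedResidual (c : 𝕜) (N : ℕ) {B : ℕ → 𝕜} (hB : ∀ k, ‖B k‖ ≤ 1) (k : ℕ) :
    ‖c‖ * ‖B (k + 1)‖ ≤ ‖truncatedResidual c N B k‖ + 4 / ((k : ℝ) + 1) := by
  have h1 := norm_scaledSum_le hB k
  have h2 : ‖if k + 1 < N then scaledSum B (k + 1) else 0‖ ≤ 2 * 1 / ((k : ℝ) + 1) := by
    split_ifs
    · refine (norm_scaledSum_le hB (k + 1)).trans ?_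
      push_cast
      gcongr
      linarith
    · rw [norm_zero]; positivity
  have h3 : c * B (k + 1) = truncatedResidual c N B k
      + (scaledSum B k - if k + 1 < N then scaledSum B (k + 1) else 0) := by
    rw [truncatedResidual]; ring
  rw [← norm_mul, h3]
  refine (norm_add_le _ _).trans (add_le_add le_rfl ((norm_sub_le _ _).trans
    ((add_le_add h1 h2).trans (le_of_eq ?_))))
  ring

/-- Otherwise normalised sequences with residual tending to 0 have a pointwise limit point, a
bounded solution of the full homogeneous recurrence, hence 0. But their unit entries stay in a
bounded range of indices, where the convergence to 0 is uniform. -/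
theorem exists_truncatedResidual_lower_bound {c : 𝕜} (hc : c ≠ 0) :
    ∃ ε > 0, ∃ N₀ : ℕ, ∀ N ≥ N₀, ∀ B : ℕ → 𝕜, B 0 = 0 → (∀ k, ‖B k‖ ≤ 1) →
      (∃ k < N, ‖B (k + 1)‖ = 1) → ∃ k < N, ε ≤ ‖truncatedResidual c N B k‖ := by
  by_contra! hcon
  choose N hN B hB0 hB1 hBk hres using fun j : ℕ =>
    hcon (1 / ((j : ℝ) + 1)) (by positivity) j
  choose l hlN hl using hBk
  obtain ⟨L, -, φ, hφ, hlim⟩ := (isCompact_univ_pi fun _ : ℕ =>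
    isCompact_closedBall (0 : 𝕜) 1).tendsto_subseq (x := B) (fun j => by
      simpa [Set.mem_pi] using hB1 j)
  rw [tendsto_pi_nhds] at hlim
  have hL1 : ∀ k, ‖L k‖ ≤ 1 := fun k =>
    le_of_tendsto (hlim k).norm (Eventually.of_forall fun j => hB1 (φ j) k)
  have hL0 : L 0 = 0 := by
    refine tendsto_nhds_unique (hlim 0) ?_
    simp [hB0]
  have hsmall : Tendsto (fun j => 1 / ((φ j : ℝ) + 1)) atTop (𝓝 0) :=
    tendsto_one_div_add_atTop_nhds_zero_nat.comp hφ.tendsto_atTop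
  have hss : ∀ k, Tendsto (fun j => scaledSum (B (φ j)) k) atTop (𝓝 (scaledSum L k)) := fun k =>
    ((hlim (k + 1)).add (hlim k)).const_smul _
  have hrec : ∀ k, c * L (k + 1) = scaledSum L k - scaledSum L (k + 1) := fun k => by
    have h1 : Tendsto (fun j => c * B (φ j) (k + 1)
        - (scaledSum (B (φ j)) k - scaledSum (B (φ j)) (k + 1))) atTop
        (𝓝 (c * L (k + 1) - (scaledSum L k - scaledSum L (k + 1)))) :=
      ((hlim (k + 1)).const_mul c).sub ((hss k).sub (hss (k + 1)))
    refine sub_eq_zero.1 (tendsto_nhds_unique h1 (squeeze_zero_norm' ?_ hsmall))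
    -- For fixed k the truncation is eventually invisible, since N (φ j) ≥ φ j.
    · filter_upwards [hφ.tendsto_atTop.eventually_ge_atTop (k + 2)] with j hj
      have hk : k + 1 < N (φ j) := lt_of_lt_of_le (by omega) (hN (φ j))
      have h3 := hres (φ j) k (by omega)
      rw [truncatedResidual, if_pos hk] at h3
      exact h3.le
  have hLzero := eq_zero_of_recurrence hc hL0 hrec hL1
  have hc' : 0 < ‖c‖ := norm_pos_iff.2 hc
  -- Once the residual is below ‖c‖/2, a unit entry at index l+1 forces ‖c‖/2 < 4/(l+1), hence l <
  -- K.
  obtain ⟨K, hK⟩ := exists_nat_gt (8 / ‖c‖)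
  have hev : ∀ᶠ j in atTop, ∀ k ∈ Finset.range K, ‖B (φ j) (k + 1)‖ < 1 :=
    (eventually_all_finset _).2 fun k _ => by
      have h := (hlim (k + 1)).norm
      rw [hLzero, norm_zero] at h
      exact h.eventually_lt_const one_pos
  obtain ⟨j, hj1, hj2⟩ := (hev.and (hsmall.eventually_lt_const (half_pos hc'))).exists
  have h1 := norm_le_of_truncatedResidual c (N (φ j)) (hB1 (φ j)) (l (φ j))
  have h2 := hres (φ j) (l (φ j)) (hlN (φ j))
  rw [hl, mul_one] at h1
  have h3 : ‖c‖ / 2 < 4 / ((l (φ j) : ℝ) + 1) := by linarith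
  have h4 : l (φ j) < K := by
    rw [lt_div_iff₀ (by positivity)] at h3
    rw [div_lt_iff₀ hc'] at hK
    have : (l (φ j) : ℝ) < K := by
      by_contra! hle
      have : (K : ℝ) * ‖c‖ ≤ (l (φ j) : ℝ) * ‖c‖ := by gcongr
      linarith
    exact_mod_cast this
  exact absurd (hl (φ j)) (hj1 _ (Finset.mem_range.2 h4)).ne

/-- By homogeneity, divide by the largest entry, which exists because B vanishes beyond N. The
threshold N₀ + 1 makes the index range nonempty. -/
theorem exists_bound_of_truncatedResidual {c : 𝕜} (hc : c ≠ 0) :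
    ∃ (C : ℝ) (N₀ : ℕ), ∀ N ≥ N₀, ∀ B : ℕ → 𝕜, B 0 = 0 → (∀ k ≥ N, B (k + 1) = 0) →
      ∀ M, (∀ k < N, ‖truncatedResidual c N B k‖ ≤ M) → ∀ k, ‖B k‖ ≤ C * M := by
  obtain ⟨ε, hε, N₀, h⟩ := exists_truncatedResidual_lower_bound hc
  refine ⟨1 / ε, N₀ + 1, fun N hN B hB0 hBN M hM => ?_⟩
  have hM0 : 0 ≤ M := (norm_nonneg _).trans (hM 0 (by omega))
  obtain ⟨k₀, hk₀, hmax⟩ := Finset.exists_max_image (Finset.range N) (fun k => ‖B (k + 1)‖)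
    ⟨0, Finset.mem_range.2 (by omega)⟩
  rw [Finset.mem_range] at hk₀
  have hle : ∀ k, ‖B k‖ ≤ ‖B (k₀ + 1)‖ := fun k => by
    rcases k with _ | k
    · rw [hB0, norm_zero]; exact norm_nonneg _
    · rcases lt_or_ge k N with hk | hk
      · exact hmax k (Finset.mem_range.2 hk)
      · rw [hBN k hk, norm_zero]; exact norm_nonneg _
  refine fun k => (hle k).trans ?_
  rcases (norm_nonneg (B (k₀ + 1))).eq_or_lt with h0 | hpos
  · rw [← h0]; positivity
  set m := ‖B (k₀ + 1)‖ with hm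
  have hnorm : ∀ k, ‖(m⁻¹ • B) k‖ = m⁻¹ * ‖B k‖ := fun k => by
    rw [Pi.smul_apply, norm_smul, Real.norm_of_nonneg (by positivity)]
  obtain ⟨k₁, hk₁, hlow⟩ := h N (by omega) (m⁻¹ • B) (by simp [hB0]) (fun k => by
      rw [hnorm, inv_mul_le_one₀ hpos]
      exact hle k)
    ⟨k₀, hk₀, by rw [hnorm, inv_mul_cancel₀ hpos.ne']⟩
  rw [truncatedResidual_smul, norm_smul, Real.norm_of_nonneg (by positivity),
    inv_mul_eq_div, le_div_iff₀ hpos] at hlow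
  rw [one_div, inv_mul_eq_div, le_div_iff₀ hε, mul_comm]
  exact hlow.trans (hM k₁ hk₁)

/-- Extension of a finite vector by zero. -/
def extendZero {N : ℕ} (v : Fin N → 𝕜) (n : ℕ) : 𝕜 := if h : n < N then v ⟨n, h⟩ else 0

/-- The sequence `0, b_0, b_1, …`. -/
def delay (b : ℕ → 𝕜) : ℕ → 𝕜
  | 0 => 0
  | n + 1 => b n

theorem sum_fin_eq_sum_range {N : ℕ} (F : ℕ → 𝕜) (v : Fin N → 𝕜) :
    ∑ j : Fin N, F j * v j = ∑ j ∈ Finset.range N, F j * extendZero v j := by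
  rw [Finset.sum_range]
  exact Finset.sum_congr rfl fun j _ => by simp [extendZero]

theorem sum_QU_mul {N i : ℕ} (hi : i < N) (b : ℕ → 𝕜) :
    ∑ j ∈ Finset.range N, ((QU i j : ℝ) : 𝕜) * b j
      = ((√Real.pi / 2 : ℝ) : 𝕜) * (b i + delay b i) := by
  have e : ∀ j, ((QU i j : ℝ) : 𝕜) * b j = ((√Real.pi / 2 : ℝ) : 𝕜)
      * ((if j = i then b j else 0) + (if i = j + 1 then b j else 0)) := fun j => by
    unfold QU
    by_cases h1 : i = j
    · subst h1; simp
    · by_cases h2 : i = j + 1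
      · subst h2; simp
      · simp [h1, h2, Ne.symm h1]
  simp only [e]
  rw [← Finset.mul_sum, Finset.sum_add_distrib, Finset.sum_ite_eq',
    if_pos (Finset.mem_range.2 hi)]
  rcases i with _ | i
  · simp [delay]
  · simp only [Nat.add_right_cancel_iff]
    rw [Finset.sum_ite_eq, if_pos (Finset.mem_range.2 (by omega))]
    rfl

theorem sum_QU_last_mul (N : ℕ) (b : ℕ → 𝕜) :
    ∑ j ∈ Finset.range N, ((QU N j : ℝ) : 𝕜) * b j
      = ((√Real.pi / 2 : ℝ) : 𝕜) * delay b N := by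
  have h := sum_QU_mul (Nat.lt_succ_self N) b
  rw [Finset.sum_range_succ] at h
  have e : QU N N = √Real.pi / 2 := by simp [QU]
  rw [e] at h
  linear_combination h

/-- In the last row i = N-1 the column i+1 is cut off; the zero extension of a makes the formula
uniform. -/
theorem sum_QP_mul {N i : ℕ} (hi : i < N) {a : ℕ → 𝕜} (ha : ∀ n ≥ N, a n = 0) :
    ∑ j ∈ Finset.range N, ((QP i j : ℝ) : 𝕜) * a j
      = ((2 / √Real.pi : ℝ) : 𝕜) * ((1 / (2 * (i : ℝ) + 1)) • a i
        - (1 / (2 * ((i + 1 : ℕ) : ℝ) + 1)) • a (i + 1)) := by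
  have e : ∀ j, ((QP i j : ℝ) : 𝕜) * a j = ((2 / √Real.pi : ℝ) : 𝕜)
      * ((if i = j then (1 / (2 * (j : ℝ) + 1)) • a j else 0)
        - (if i + 1 = j then (1 / (2 * (j : ℝ) + 1)) • a j else 0)) := fun j => by
    unfold QP
    simp only [RCLike.real_smul_eq_coe_mul]
    by_cases h1 : i = j
    · subst h1; simp; ring
    · by_cases h2 : i + 1 = j
      · subst h2; simp; ring
      · simp [h1, h2]
  simp only [e]
  rw [← Finset.mul_sum, Finset.sum_sub_distrib, Finset.sum_ite_eq, Finset.sum_ite_eq,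
    if_pos (Finset.mem_range.2 hi)]
  by_cases h : i + 1 ∈ Finset.range N
  · rw [if_pos h]
  · rw [if_neg h, ha (i + 1) (by simpa using h), smul_zero]

/-! ### Elimination of the Legendre coefficients from the finite section -/

theorem finiteSection_mulVec_inl (σ : 𝕜) {N : ℕ} (c : Fin N ⊕ Fin N → 𝕜) (i : Fin N) :
    (finiteSection σ N).mulVec c (Sum.inl i)
      = σ * c (Sum.inl i) + ∑ j : Fin N, ((QU i j : ℝ) : 𝕜) * c (Sum.inr j) := by
  simp [finiteSection, systemMatrix, Matrix.mulVec, dotProduct, Matrix.one_apply, Fin.val_inj]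

theorem finiteSection_mulVec_inr (σ : 𝕜) {N : ℕ} (c : Fin N ⊕ Fin N → 𝕜) (i : Fin N) :
    (finiteSection σ N).mulVec c (Sum.inr i)
      = σ * c (Sum.inr i) + ∑ j : Fin N, ((QP i j : ℝ) : 𝕜) * c (Sum.inl j) := by
  simp [finiteSection, systemMatrix, Matrix.mulVec, dotProduct, Matrix.one_apply, Fin.val_inj,
    add_comm]

/-- Multiplying the second block row by σ and inserting σa from the first gives the scalar
recurrence with c = σ²; the factors 2/√π and √π/2 cancel. Bounding b alone is enough for both the
leaked term and injectivity. -/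
theorem exists_bound_of_finiteSection_mulVec {σ : 𝕜} (hσ : σ ≠ 0) :
    ∃ (C : ℝ) (N₀ : ℕ), ∀ N ≥ N₀, ∀ (c : Fin N ⊕ Fin N → 𝕜) (M : ℝ),
      (∀ i, ‖(finiteSection σ N).mulVec c i‖ ≤ M) → ∀ n, ‖c (Sum.inr n)‖ ≤ C * M := by
  obtain ⟨C, N₀, h⟩ := exists_bound_of_truncatedResidual (pow_ne_zero 2 hσ)
  refine ⟨C * (‖σ‖ + 2 / √Real.pi * 2), N₀, fun N hN c M hM n => ?_⟩
  have hM0 : 0 ≤ M := (norm_nonneg _).trans (hM (Sum.inl n))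
  set a := extendZero (fun j => c (Sum.inl j)) with ha
  set b := extendZero (fun j => c (Sum.inr j)) with hb
  set r := extendZero (fun j => (finiteSection σ N).mulVec c (Sum.inl j)) with hr
  set s := extendZero (fun j => (finiteSection σ N).mulVec c (Sum.inr j)) with hs
  have haN : ∀ k ≥ N, a k = 0 := fun k hk => by simp [ha, extendZero, hk]
  have hbN : ∀ k ≥ N, b k = 0 := fun k hk => by simp [hb, extendZero, hk]
  have hrM : ∀ k, ‖r k‖ ≤ M := fun k => by
    rw [hr]; unfold extendZero
    split_ifs
    · exact hM _
    · simpa using hM0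
  have hsM : ∀ k, ‖s k‖ ≤ M := fun k => by
    rw [hs]; unfold extendZero
    split_ifs
    · exact hM _
    · simpa using hM0
  have hrow1 : ∀ k < N, σ * a k
      = r k - ((√Real.pi / 2 : ℝ) : 𝕜) * (delay b (k + 1) + delay b k) := fun k hk => by
    have h1 := finiteSection_mulVec_inl σ c ⟨k, hk⟩
    rw [sum_fin_eq_sum_range (fun j => ((QU k j : ℝ) : 𝕜)) (fun j => c (Sum.inr j)),
      sum_QU_mul hk] at h1
    have h2 : r k = (finiteSection σ N).mulVec c (Sum.inl ⟨k, hk⟩) := by simp [hr, extendZero, hk]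
    have h3 : a k = c (Sum.inl ⟨k, hk⟩) := by simp [ha, extendZero, hk]
    rw [h2, h1, h3]
    simp only [delay, hb]
    ring
  have hrow2 : ∀ k < N, σ * b k = s k - ((2 / √Real.pi : ℝ) : 𝕜)
      * ((1 / (2 * (k : ℝ) + 1)) • a k
        - (1 / (2 * ((k + 1 : ℕ) : ℝ) + 1)) • a (k + 1)) := fun k hk => by
    have h1 := finiteSection_mulVec_inr σ c ⟨k, hk⟩
    rw [sum_fin_eq_sum_range (fun j => ((QP k j : ℝ) : 𝕜)) (fun j => c (Sum.inl j)),
      sum_QP_mul hk haN] at h1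
    have h2 : s k = (finiteSection σ N).mulVec c (Sum.inr ⟨k, hk⟩) := by simp [hs, extendZero, hk]
    have h3 : b k = c (Sum.inr ⟨k, hk⟩) := by simp [hb, extendZero, hk]
    rw [h2, h1, h3]
    ring
  have hpi : ((2 / √Real.pi : ℝ) : 𝕜) * ((√Real.pi / 2 : ℝ) : 𝕜) = 1 := by
    have hp0 : √Real.pi ≠ 0 := (Real.sqrt_pos.2 Real.pi_pos).ne'
    rw [← RCLike.ofReal_mul, div_mul_div_cancel₀' two_ne_zero, div_self hp0, RCLike.ofReal_one]
  have hscaled : ∀ k < N, ((2 / √Real.pi : ℝ) : 𝕜) * (σ * (1 / (2 * (k : ℝ) + 1)) • a k)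
      = ((2 / √Real.pi : ℝ) : 𝕜) * (1 / (2 * (k : ℝ) + 1)) • r k - scaledSum (delay b) k :=
    fun k hk => by
      rw [mul_smul_comm, hrow1 k hk, scaledSum, smul_sub, mul_sub]
      congr 1
      rw [mul_smul_comm, ← mul_assoc, hpi, one_mul]
  have hres : ∀ k < N, truncatedResidual (σ ^ 2) N (delay b) k
      = σ * s k - ((2 / √Real.pi : ℝ) : 𝕜) * ((1 / (2 * (k : ℝ) + 1)) • r k
        - (1 / (2 * ((k + 1 : ℕ) : ℝ) + 1)) • r (k + 1)) := fun k hk => by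
    have h1 := hrow2 k hk
    have h2 := hscaled k hk
    unfold truncatedResidual
    by_cases hk1 : k + 1 < N
    · have h3 := hscaled (k + 1) hk1
      rw [if_pos hk1]
      simp only [delay]
      linear_combination σ * h1 - h2 + h3
    -- Last row: a_N = 0 and there is no first-block row N, which is why `truncatedResidual` drops
    -- its second term.
    · rw [if_neg hk1]
      have h4 : a (k + 1) = 0 := haN _ (not_lt.1 hk1)
      have h5 : r (k + 1) = 0 := by simp [hr, extendZero, hk1]
      rw [h4, smul_zero] at h1
      rw [h5, smul_zero]
      simp only [delay]
      linear_combination σ * h1 - h2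
  have hsm : ∀ k : ℕ, ‖(1 / (2 * (k : ℝ) + 1)) • r k‖ ≤ M := fun k => by
    rw [norm_smul, Real.norm_of_nonneg (by positivity)]
    refine (mul_le_of_le_one_left (norm_nonneg _) ?_).trans (hrM k)
    rw [div_le_one (by positivity)]
    linarith [Nat.cast_nonneg (α := ℝ) k]
  have key := h N hN (delay b) rfl (fun k hk => hbN k hk) ((‖σ‖ + 2 / √Real.pi * 2) * M)
    (fun k hk => by
      rw [hres k hk]
      refine (norm_sub_le _ _).trans ?_
      rw [norm_mul, norm_mul, RCLike.norm_of_nonneg (by positivity), add_mul, mul_assoc (2 / _)]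
      refine add_le_add (mul_le_mul_of_nonneg_left (hsM k) (norm_nonneg _))
        (mul_le_mul_of_nonneg_left ((norm_sub_le _ _).trans ?_) (by positivity))
      linarith [hsm k, hsm (k + 1)]) (n + 1)
  have h3 : delay b (n + 1) = c (Sum.inr n) := by simp [delay, hb, extendZero]
  rw [h3] at key
  rw [mul_assoc]
  exact key

end Stability

/-! ### Convergence of the finite section method -/

section Convergence

variable {𝕜 : Type*} [RCLike 𝕜]

/-- The element of `L²[-1,1]` with the given coefficients. -/
noncomputable def expansionL2 {N : ℕ} (c : Fin N ⊕ Fin N → 𝕜) : L2 𝕜 :=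
  ∑ n : Fin N, c (Sum.inl n) • legendreL2 𝕜 n + ∑ n : Fin N, c (Sum.inr n) • chebyshevL2 𝕜 n

theorem coeFn_expansionL2 {N : ℕ} (c : Fin N ⊕ Fin N → 𝕜) :
    expansionL2 c =ᵐ[vol] expansion c := by
  filter_upwards [Lp.coeFn_add (∑ n : Fin N, c (Sum.inl n) • legendreL2 𝕜 n)
      (∑ n : Fin N, c (Sum.inr n) • chebyshevL2 𝕜 n),
    coeFn_sum_smul Finset.univ (fun n : Fin N => c (Sum.inl n))
      (fun n => coeFn_legendreL2 (𝕜 := 𝕜) n),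
    coeFn_sum_smul Finset.univ (fun n : Fin N => c (Sum.inr n))
      (fun n => coeFn_chebyshevL2 (𝕜 := 𝕜) n)] with x h1 h2 h3
  rw [expansionL2, h1, Pi.add_apply, h2, h3, expansion, Finset.mul_sum]
  congr 1
  refine Finset.sum_congr rfl fun n _ => ?_
  push_cast
  ring

theorem expansionL2_truncatedRhs (a b : ℕ → 𝕜) (N : ℕ) :
    expansionL2 (truncatedRhs a b N) = ∑ n ∈ Finset.range N, a n • legendreL2 𝕜 n
      + ∑ n ∈ Finset.range N, b n • chebyshevL2 𝕜 n := by
  rw [Finset.sum_range, Finset.sum_range]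
  rfl

/-- The operator `σ I + Q^{1/2}` acts on a finite expansion as the finite section, up to a
multiple of `P_N`. -/
theorem apply_expansionL2 (σ : 𝕜) {N : ℕ} (c : Fin N ⊕ Fin N → 𝕜) :
    (σ • (1 : L2 𝕜 →L[𝕜] L2 𝕜) + halfIntegralL2 𝕜) (expansionL2 c)
      = expansionL2 ((finiteSection σ N).mulVec c)
        + (∑ n : Fin N, ((QU N n : ℝ) : 𝕜) * c (Sum.inr n)) • legendreL2 𝕜 N := by
  have h1 : ∀ n : Fin N, c (Sum.inl n) • halfIntegralL2 𝕜 (legendreL2 𝕜 n)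
      = ∑ k : Fin N, (((QP k n : ℝ) : 𝕜) * c (Sum.inl n)) • chebyshevL2 𝕜 k := fun n => by
    rw [halfIntegralL2_legendreL2 n.2, Finset.sum_range, Finset.smul_sum]
    exact Finset.sum_congr rfl fun k _ => by rw [smul_smul, mul_comm]
  have h2 : ∀ n : Fin N, c (Sum.inr n) • halfIntegralL2 𝕜 (chebyshevL2 𝕜 n)
      = ∑ k : Fin N, (((QU k n : ℝ) : 𝕜) * c (Sum.inr n)) • legendreL2 𝕜 k
        + (((QU N n : ℝ) : 𝕜) * c (Sum.inr n)) • legendreL2 𝕜 N := fun n => by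
    rw [halfIntegralL2_chebyshevL2 n.2, Finset.sum_range_succ, Finset.sum_range, smul_add,
      Finset.smul_sum, smul_smul, mul_comm (c _)]
    congr 1
    exact Finset.sum_congr rfl fun k _ => by rw [smul_smul, mul_comm]
  have hQ : halfIntegralL2 𝕜 (expansionL2 c)
      = ∑ k : Fin N, (∑ n : Fin N, ((QP k n : ℝ) : 𝕜) * c (Sum.inl n)) • chebyshevL2 𝕜 k
        + (∑ k : Fin N, (∑ n : Fin N, ((QU k n : ℝ) : 𝕜) * c (Sum.inr n)) • legendreL2 𝕜 k
        + (∑ n : Fin N, ((QU N n : ℝ) : 𝕜) * c (Sum.inr n)) • legendreL2 𝕜 N) := by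
    simp only [expansionL2, map_add, map_sum, map_smul, h1, h2, Finset.sum_add_distrib,
      Finset.sum_smul]
    rw [Finset.sum_comm]
    congr 2
    rw [Finset.sum_comm]
  rw [add_apply, hQ, smul_apply,
    one_apply_eq_self]
  simp only [expansionL2, finiteSection_mulVec_inl, finiteSection_mulVec_inr, add_smul,
    Finset.sum_add_distrib, mul_smul, smul_add, Finset.smul_sum]
  abel

theorem norm_sum_QU_last_mul_le {N : ℕ} {v : Fin N → 𝕜} {D : ℝ} (hD : 0 ≤ D)
    (hv : ∀ n, ‖v n‖ ≤ D) :
    ‖∑ n : Fin N, ((QU N n : ℝ) : 𝕜) * v n‖ ≤ √Real.pi / 2 * D := by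
  rw [sum_fin_eq_sum_range (fun j => ((QU N j : ℝ) : 𝕜)) v, sum_QU_last_mul, norm_mul,
    RCLike.norm_of_nonneg (by positivity)]
  refine mul_le_mul_of_nonneg_left ?_ (by positivity)
  rcases N with _ | N
  · simpa [delay] using hD
  · simpa [delay, extendZero] using hv ⟨N, Nat.lt_succ_self N⟩

/-- On the kernel the bound with M = 0 gives b = 0, and then the first block row reads σa = 0. -/
theorem isUnit_finiteSection {σ : 𝕜} (hσ : σ ≠ 0) :
    ∀ᶠ N : ℕ in atTop, IsUnit (finiteSection σ N) := by
  obtain ⟨C, N₀, h⟩ := exists_bound_of_finiteSection_mulVec hσ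
  filter_upwards [eventually_ge_atTop N₀] with N hN
  rw [← Matrix.mulVec_injective_iff_isUnit, ← Matrix.coe_mulVecLin, injective_iff_map_eq_zero]
  intro c hc
  rw [Matrix.mulVecLin_apply] at hc
  have hb : ∀ n, c (Sum.inr n) = 0 := fun n => by
    simpa using h N hN c 0 (fun i => by simp [hc]) n
  funext i
  rcases i with i | i
  · have h1 := finiteSection_mulVec_inl σ c i
    rw [hc] at h1
    simpa [hb, hσ] using h1.symm
  · exact hb i

theorem tendsto_L2_iff {v : ℕ → L2 𝕜} {w : L2 𝕜} {g : ℕ → ℝ → 𝕜}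
    (hg : ∀ N, ∀ᵐ x ∂vol, g N x = v N x - w x) :
    Tendsto v atTop (𝓝 w) ↔ Tendsto (fun N => eLpNorm (g N) 2 vol) atTop (𝓝 0) := by
  have e : ∀ N, eLpNorm (g N) 2 vol = eLpNorm (v N - w : L2 𝕜) 2 vol := fun N => by
    refine eLpNorm_congr_ae ?_
    filter_upwards [hg N, Lp.coeFn_sub (v N) w] with x h1 h2
    rw [h1, h2, Pi.sub_apply]
  simp only [e]
  rw [tendsto_iff_norm_sub_tendsto_zero]
  simp only [Lp.norm_def]
  exact ENNReal.tendsto_toReal_zero_iff fun N => Lp.eLpNorm_ne_top _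

/-- Since ‖P_n‖ ≤ ‖P_0‖, the series converges absolutely in L², hence also almost everywhere, which
identifies its sum with e. -/
theorem exists_tendsto_sum_legendreL2 {a : ℕ → 𝕜} (ha : Summable fun n => ‖a n‖) {e : ℝ → 𝕜}
    (he : ∀ᵐ x ∂vol, HasSum (fun n => a n * ((P n x : ℝ) : 𝕜)) (e x)) :
    ∃ E : L2 𝕜, E =ᵐ[vol] e ∧
      Tendsto (fun N => ∑ n ∈ Finset.range N, a n • legendreL2 𝕜 n) atTop (𝓝 E) := by
  have hs : Summable fun n => ‖a n • legendreL2 𝕜 n‖ := by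
    refine Summable.of_nonneg_of_le (fun _ => norm_nonneg _) (fun n => ?_)
      (ha.mul_right ‖legendreL2 𝕜 0‖)
    rw [norm_smul]
    exact mul_le_mul_of_nonneg_left (norm_legendreL2_le_of_le (Nat.zero_le n)) (norm_nonneg _)
  refine ⟨∑' n, a n • legendreL2 𝕜 n, ?_, hs.of_norm.hasSum.tendsto_sum_nat⟩
  have hne : ∑' n, ‖a n • legendreL2 𝕜 n‖ₑ ≠ ⊤ := by
    simp only [enorm_eq_nnnorm]
    exact ENNReal.tsum_coe_ne_top_iff_summable.2 (NNReal.summable_coe.1 hs)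
  have hae : ∀ᵐ x ∂vol, ∀ n, (a n • legendreL2 𝕜 n : L2 𝕜) x = a n * ((P n x : ℝ) : 𝕜) :=
    ae_all_iff.2 fun n => by
      filter_upwards [Lp.coeFn_smul (a n) (legendreL2 𝕜 n), coeFn_legendreL2 (𝕜 := 𝕜) n]
        with x h1 h2
      rw [h1, Pi.smul_apply, h2, smul_eq_mul]
  filter_upwards [Lp.hasSum_coeFn_tsum hne, hae, he] with x h1 h2 h3
  simp only [h2] at h1
  exact h1.unique h3

theorem exists_tendsto_sum_chebyshevL2 {b : ℕ → 𝕜} {f : ℝ → 𝕜}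
    (hf : ∀ᵐ x ∂vol, HasSum (fun n => b n * ((U n x : ℝ) : 𝕜)) (f x))
    (hfL2 : Tendsto (fun N : ℕ => eLpNorm (fun x => ((√(1 + x) : ℝ) : 𝕜) *
        (∑ n ∈ Finset.range N, b n * ((U n x : ℝ) : 𝕜) - f x)) 2 vol) atTop (𝓝 0)) :
    ∃ F : L2 𝕜, F =ᵐ[vol] (fun x => ((√(1 + x) : ℝ) : 𝕜) * f x) ∧
      Tendsto (fun N => ∑ n ∈ Finset.range N, b n • chebyshevL2 𝕜 n) atTop (𝓝 F) := by
  have hcU : ∀ n, Continuous fun x => ((U n x : ℝ) : 𝕜) := fun n =>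
    RCLike.continuous_ofReal.comp (continuous_U n)
  have hcs : Continuous fun x : ℝ => ((√(1 + x) : ℝ) : 𝕜) :=
    RCLike.continuous_ofReal.comp (by fun_prop)
  have hcsum : ∀ N, Continuous fun x => ∑ n ∈ Finset.range N, b n * ((U n x : ℝ) : 𝕜) :=
    fun N => continuous_finsetSum _ fun n _ => continuous_const.mul (hcU n)
  have hfm : AEStronglyMeasurable f vol := by
    refine aestronglyMeasurable_of_tendsto_ae atTop (fun N => (hcsum N).aestronglyMeasurable) ?_
    filter_upwards [hf] with x hx using hx.tendsto_sum_nat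
  -- One N with finite error norm shows that √(1+x) f is square integrable: it is a continuous
  -- function minus an L² function.
  obtain ⟨N, hN⟩ := (hfL2.eventually_lt_const ENNReal.zero_lt_top).exists
  have hdiff : MemLp (fun x => ((√(1 + x) : ℝ) : 𝕜) *
      (∑ n ∈ Finset.range N, b n * ((U n x : ℝ) : 𝕜) - f x)) 2 vol :=
    ⟨hcs.aestronglyMeasurable.mul ((hcsum N).aestronglyMeasurable.sub hfm), hN⟩
  have hF : MemLp (fun x => ((√(1 + x) : ℝ) : 𝕜) * f x) 2 vol := by
    refine ((memLp_of_continuous (hcs.mul (hcsum N))).sub hdiff).ae_eq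
      (Eventually.of_forall fun x => ?_)
    simp only [Pi.sub_apply, Pi.mul_apply]
    ring
  refine ⟨hF.toLp _, hF.coeFn_toLp, (tendsto_L2_iff fun N => ?_).2 hfL2⟩
  filter_upwards [hF.coeFn_toLp, coeFn_sum_smul (Finset.range N) b
    (fun n => coeFn_chebyshevL2 (𝕜 := 𝕜) n)] with x h1 h2
  rw [h1, h2, mul_sub, Finset.mul_sum]
  congr 1
  refine Finset.sum_congr rfl fun n _ => ?_
  push_cast
  ring

theorem apply_eq_iff_ae (σ : 𝕜) {v r : L2 𝕜} {g : ℝ → 𝕜} (hr : r =ᵐ[vol] g) :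
    (σ • (1 : L2 𝕜 →L[𝕜] L2 𝕜) + halfIntegralL2 𝕜) v = r
      ↔ ∀ᵐ x ∂vol, σ * v x + halfIntegral v x = g x := by
  rw [add_apply, smul_apply,
    one_apply_eq_self]
  have h : (σ • v + halfIntegralL2 𝕜 v : L2 𝕜) =ᵐ[vol] fun x => σ * v x + halfIntegral v x := by
    filter_upwards [Lp.coeFn_add (σ • v) (halfIntegralL2 𝕜 v), Lp.coeFn_smul σ v,
      halfIntegralL2_ae v] with x h1 h2 h3
    rw [h1, Pi.add_apply, h2, h3, Pi.smul_apply, smul_eq_mul]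
  refine ⟨fun hv => ?_, fun hv => Lp.ext (h.trans (EventuallyEq.trans hv hr.symm))⟩
  rw [hv] at h
  exact h.symm.trans hr

/-- A maps the approximation to the truncated right-hand side plus τ_N P_N. The bound on b keeps τ_N
bounded while ‖P_N‖ → 0, and K is continuous. -/
theorem tendsto_expansionL2 {σ : 𝕜} (hσ : σ ≠ 0)
    {A K : L2 𝕜 →L[𝕜] L2 𝕜} (hA : A = σ • (1 : L2 𝕜 →L[𝕜] L2 𝕜) + halfIntegralL2 𝕜)
    (hKA : ∀ v, K (A v) = v) {a b : ℕ → 𝕜} {M : ℝ} (ha : ∀ n, ‖a n‖ ≤ M) (hb : ∀ n, ‖b n‖ ≤ M)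
    {r : L2 𝕜} (hr : Tendsto (fun N => expansionL2 (truncatedRhs a b N)) atTop (𝓝 r)) :
    Tendsto (fun N => expansionL2 ((finiteSection σ N)⁻¹.mulVec (truncatedRhs a b N))) atTop
      (𝓝 (K r)) := by
  obtain ⟨C, N₀, hC⟩ := exists_bound_of_finiteSection_mulVec hσ
  set c : ∀ N : ℕ, Fin N ⊕ Fin N → 𝕜 :=
    fun N => (finiteSection σ N)⁻¹.mulVec (truncatedRhs a b N) with hc
  set τ : ℕ → 𝕜 := fun N => ∑ n : Fin N, ((QU N n : ℝ) : 𝕜) * c N (Sum.inr n) with hτ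
  have hsol : ∀ᶠ N in atTop, (finiteSection σ N).mulVec (c N) = truncatedRhs a b N := by
    filter_upwards [isUnit_finiteSection hσ] with N hN
    rw [hc, Matrix.mulVec_mulVec, Matrix.mul_nonsing_inv _ ((Matrix.isUnit_iff_isUnit_det _).1 hN),
      Matrix.one_mulVec]
  -- The absolute value is there because C comes with no sign.
  have hτb : ∀ᶠ N in atTop, ‖τ N • legendreL2 𝕜 N‖
      ≤ √Real.pi / 2 * |C * M| * ‖legendreL2 𝕜 N‖ := by
    filter_upwards [hsol, eventually_ge_atTop N₀] with N hN hN₀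
    rw [norm_smul]
    refine mul_le_mul_of_nonneg_right (norm_sum_QU_last_mul_le (abs_nonneg _) fun n => ?_)
      (norm_nonneg _)
    refine (hC N hN₀ (c N) M (fun i => ?_) n).trans (le_abs_self _)
    rw [hN]
    rcases i with i | i
    · exact ha i
    · exact hb i
  have hτ0 : Tendsto (fun N => τ N • legendreL2 𝕜 N) atTop (𝓝 0) :=
    squeeze_zero_norm' hτb (by simpa using tendsto_norm_legendreL2.const_mul _)
  have hlim := (K.continuous.tendsto _).comp (hr.add hτ0)
  rw [add_zero] at hlim
  refine hlim.congr' ?_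
  filter_upwards [hsol] with N hN
  change K (expansionL2 (truncatedRhs a b N) + τ N • legendreL2 𝕜 N) = expansionL2 (c N)
  rw [← hN, ← apply_expansionL2, ← hA, hKA]

end Convergence

end HalfOrder

/-! ### The convergence theorem -/

theorem theoremB1 {𝕜 : Type*} [RCLike 𝕜] (σ : 𝕜)
    (hσ : IsUnit (σ • (1 : HalfOrder.L2 𝕜 →L[𝕜] HalfOrder.L2 𝕜) + HalfOrder.halfIntegralL2 𝕜))
    (eCoeff fCoeff : ℕ → 𝕜)
    (heCoeff : Summable fun n => ‖eCoeff n‖) (hfCoeff : Summable fun n => ‖fCoeff n‖)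
    (e f : ℝ → 𝕜)
    (he : ∀ᵐ x ∂HalfOrder.vol, HasSum (fun n => eCoeff n * ((HalfOrder.P n x : ℝ) : 𝕜)) (e x))
    (hf : ∀ᵐ x ∂HalfOrder.vol, HasSum (fun n => fCoeff n * ((HalfOrder.U n x : ℝ) : 𝕜)) (f x))
    (hfL2 : Tendsto (fun N : ℕ => eLpNorm (fun x => ((√(1 + x) : ℝ) : 𝕜) *
        (∑ n ∈ Finset.range N, fCoeff n * ((HalfOrder.U n x : ℝ) : 𝕜) - f x)) 2 HalfOrder.vol)
      atTop (𝓝 0)) :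
    ∃ u : HalfOrder.L2 𝕜,
      (∀ᵐ x ∂HalfOrder.vol,
        σ * u x + HalfOrder.halfIntegral u x = e x + ((√(1 + x) : ℝ) : 𝕜) * f x) ∧
      (∀ v : HalfOrder.L2 𝕜, (∀ᵐ x ∂HalfOrder.vol,
        σ * v x + HalfOrder.halfIntegral v x = e x + ((√(1 + x) : ℝ) : 𝕜) * f x) → v = u) ∧
      (∀ᶠ N : ℕ in atTop, IsUnit (HalfOrder.finiteSection σ N)) ∧
      Tendsto (fun N : ℕ => eLpNorm (fun x => HalfOrder.expansion
          ((HalfOrder.finiteSection σ N)⁻¹.mulVec (HalfOrder.truncatedRhs eCoeff fCoeff N)) x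
            - u x) 2 HalfOrder.vol) atTop (𝓝 0) := by

  have hσ0 : σ ≠ 0 := by
    rintro rfl
    rw [zero_smul, zero_add] at hσ
    exact HalfOrder.not_isUnit_halfIntegralL2 hσ
  obtain ⟨A, hA⟩ := hσ
  have hKA : ∀ v, (A⁻¹).val (A.val v) = v := fun v =>
    congrArg (fun T : HalfOrder.L2 𝕜 →L[𝕜] HalfOrder.L2 𝕜 => T v) (Units.inv_mul A)
  have hAK : ∀ v, A.val ((A⁻¹).val v) = v := fun v =>
    congrArg (fun T : HalfOrder.L2 𝕜 →L[𝕜] HalfOrder.L2 𝕜 => T v) (Units.mul_inv A)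
  obtain ⟨E, hEe, hE⟩ := HalfOrder.exists_tendsto_sum_legendreL2 heCoeff he
  obtain ⟨F, hFf, hF⟩ := HalfOrder.exists_tendsto_sum_chebyshevL2 hf hfL2
  have hr : (E + F : HalfOrder.L2 𝕜) =ᵐ[HalfOrder.vol]
      fun x => e x + ((√(1 + x) : ℝ) : 𝕜) * f x := by
    filter_upwards [Lp.coeFn_add E F, hEe, hFf] with x h1 h2 h3
    rw [h1, Pi.add_apply, h2, h3]
  refine ⟨(A⁻¹).val (E + F), ?_, fun v hv => ?_, HalfOrder.isUnit_finiteSection hσ0, ?_⟩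
  · rw [← HalfOrder.apply_eq_iff_ae σ hr, ← hA, hAK]
  · rw [← HalfOrder.apply_eq_iff_ae σ hr, ← hA] at hv
    rw [← hv, hKA]
  · refine (HalfOrder.tendsto_L2_iff fun N => ?_).1 (HalfOrder.tendsto_expansionL2 hσ0 hA hKA
      -- Only a common bound for all coefficients is needed; the sum of the two ℓ¹ norms is one.
      (M := (∑' n, ‖eCoeff n‖) + ∑' n, ‖fCoeff n‖) (r := E + F) (a := eCoeff) (b := fCoeff) (fun n => ?_)
      (fun n => ?_) ?_)
    · filter_upwards [HalfOrder.coeFn_expansionL2 ((HalfOrder.finiteSection σ N)⁻¹.mulVec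
        (HalfOrder.truncatedRhs eCoeff fCoeff N))] with x hx
      rw [hx]
    · have h1 := heCoeff.le_tsum n fun _ _ => norm_nonneg _
      have h2 : 0 ≤ ∑' n, ‖fCoeff n‖ := tsum_nonneg fun _ => norm_nonneg _
      linarith
    · have h1 := hfCoeff.le_tsum n fun _ _ => norm_nonneg _
      have h2 : 0 ≤ ∑' n, ‖eCoeff n‖ := tsum_nonneg fun _ => norm_nonneg _
      linarith
    · simp only [HalfOrder.expansionL2_truncatedRhs]
      exact hE.add hF
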